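/- Let $K$ be a field and let $f=p/q\in K(z)$ be a rational function of degree $d=\max(\deg p,\deg q)\ge 2$, where $p,q\in K[z]$ are coprime. Let $t$ be transcendental over $K$, fix a separable closure $K(t)^{\mathrm{sep}}$ of $K(t)$, and let $K^{\mathrm{sep}}$ be the separable closure of $K$ in it. The group $\mathrm{Gal}(K(t)^{\mathrm{sep}}/K(t))$ acts on the rooted tree of preimages $T=\bigsqcup_{n\ge 0}f^{-n}(t)$, whose edges join each $x\in f^{-(n+1)}(t)$ to $f(x)\in f^{-n}(t)$; let $G_\infty(K,f,t)\le\mathrm{Aut}\,T$ be the image of this group, and let $G_\infty(K^{\mathrm{sep}},f,t)$ be the image of the subgroup $\mathrm{Gal}(K(t)^{\mathrm{sep}}/K^{\mathrm{sep}}(t))$. For $\alpha\in K$, let likewise $G_\infty(K,f,\alpha)$ be the image of $\mathrm{Gal}(K^{\mathrm{sep}}/K)$ in the automorphism group of the tree $T_\alpha=\bigsqcup_{n\ge0}f^{-n}(\alpha)$ of preimages in $\mathbb P^1(K^{\mathrm{sep}})$. For a group $G$ of automorphisms of one of these rooted trees, let $\pi_n(G)$ be the permutation group that $G$ induces on the $n$-th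 level, and let $$\mathrm{FPP}(G)=\lim_{n\to\infty}\frac{\#\{g\in\pi_n(G)\mid g\text{ fixes a vertex at level }n\}}{|\pi_n(G)|}.$$ Put $Q=\pi_1(G_\infty(K,f,t))/\pi_1(G_\infty(K^{\mathrm{sep}},f,t))$. Suppose that $f$ has bad monodromy, that is, that there is a nonempty set $M\subseteq Q$ of cosets such that every element of every coset in $M$ fixes some (possibly depending on the element) point of $f^{-1}(t)$, and let $M$ be such a set. Then the limit defining $\mathrm{FPP}(G_\infty(K,f,t))$ exists and $$\mathrm{FPP}(G_\infty(K,f,t))\ \ge\ \frac{\#M}{|Q|}\ >\ 0.$$ Moreover, let $\alpha\in K$ be not strictly post-critical, that is, $\alpha\notin\bigcup_{n\ge1}f^n(C_f)$, where $C_f\subseteq\mathbb P^1(\overline K)$ is the set of critical (that is, ramification) points of $f$. If $\pi_1(G_\infty(K,f,t))=\pi_1(G_\infty(K,f,\alpha))$ as permutation groups, that is, if some bijection $f^{-1}(t)\to f^{-1}(\alpha)$ carries the first group to the second, then the limit defining $\mathrm{FPP}(G_\infty(K,f,\alpha))$ exists and $$\mathrm{FPP}(G_\infty(K,f,\alpha))\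 \ge\ \frac{\#M}{|Q|}\ >\ 0.$$ -/

import Mathlib

open Filter Topology

namespace IteratedGalois

section Maps

variable {K : Type*} [Field K]

/-- The degree of a rational function `f = p / q` in lowest terms, `max (deg p) (deg q)`. -/
noncomputable def ratDegree (f : RatFunc K) : ℕ :=
  max f.num.natDegree f.denom.natDegree

open Classical in
/-- The self-map of `ℙ¹(A) = A ∪ {∞}` induced by `f = p / q ∈ K(z)`, for a field `A` over `K`. -/
noncomputable def ratMap (f : RatFunc K) (A : Type*) [Field A] [Algebra K A] :
    OnePoint A → OnePoint A
  | OnePoint.infty =>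
      if f.denom.coeff (ratDegree f) = 0 then OnePoint.infty
      else OnePoint.some
        (algebraMap K A (f.num.coeff (ratDegree f) / f.denom.coeff (ratDegree f)))
  | OnePoint.some a =>
      if Polynomial.aeval a f.denom = 0 then OnePoint.infty
      else OnePoint.some (Polynomial.aeval a f.num / Polynomial.aeval a f.denom)

/-- The polynomial `p - b q` (and `q` for `b = ∞`). Read as a binary form of degree `deg f`, its
zeros on `ℙ¹` are the preimages of `b` under `f = p / q`, with multiplicity. -/
noncomputable def fiberPoly (f : RatFunc K) (A : Type*) [Field A] [Algebra K A] :
    OnePoint A → Polynomial A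
  | OnePoint.infty => f.denom.map (algebraMap K A)
  | OnePoint.some b =>
      f.num.map (algebraMap K A) - Polynomial.C b * f.denom.map (algebraMap K A)

/-- The ramification index of `f` at a point `x` of `ℙ¹(A)`: the multiplicity of `x` as a preimage
of `f(x)`. -/
noncomputable def ramificationIndex (f : RatFunc K) (A : Type*) [Field A] [Algebra K A] :
    OnePoint A → ℕ
  | OnePoint.infty =>
      ratDegree f - (fiberPoly f A (ratMap f A OnePoint.infty)).natDegree
  | OnePoint.some a =>
      (fiberPoly f A (ratMap f A (OnePoint.some a))).rootMultiplicity a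

/-- The set `C_f` of critical points of `f`, in `ℙ¹` of an algebraic closure of `K`. -/
def criticalPoints (f : RatFunc K) : Set (OnePoint (AlgebraicClosure K)) :=
  {c | 2 ≤ ramificationIndex f (AlgebraicClosure K) c}

/-- `α ∈ K` is strictly post-critical for `f` if it lies in `⋃_{n ≥ 1} fⁿ(C_f)`. -/
def IsStrictlyPostCritical (f : RatFunc K) (α : K) : Prop :=
  ∃ n : ℕ, 1 ≤ n ∧ ∃ c ∈ criticalPoints f,
    (ratMap f (AlgebraicClosure K))^[n] c =
      OnePoint.some (algebraMap K (AlgebraicClosure K) α)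

end Maps

section Tree

variable {K : Type*} [Field K] {Ω : Type*} [Field Ω] [Algebra K Ω]

/-- The `n`-th level `f⁻ⁿ(β) ⊆ ℙ¹(Ω)` of the tree of preimages of `β`. The tree is the
disjoint union of its levels. -/
def Level (f : RatFunc K) (β : Ω) (n : ℕ) : Type _ :=
  {x : OnePoint Ω // (ratMap f Ω)^[n] x = OnePoint.some β}

/-- The edges of the tree of preimages: `x` at level `n + 1` is a child of `f x` at level `n`. -/
noncomputable def parent (f : RatFunc K) (β : Ω) (n : ℕ) (x : Level f β (n + 1)) :
    Level f β n :=
  ⟨ratMap f Ω x.1, x.2⟩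

/-- The group `Aut T` of automorphisms of the rooted tree of preimages of `β`: families of
permutations of the levels which are compatible with the edges. -/
def treeAut (f : RatFunc K) (β : Ω) : Subgroup (∀ n, Equiv.Perm (Level f β n)) where
  carrier := {g | ∀ n x, parent f β n (g (n + 1) x) = g n (parent f β n x)}
  mul_mem' := by
    intro a b ha hb n x
    simp only [Pi.mul_apply, Equiv.Perm.mul_apply, ha n, hb n]
  one_mem' := by
    intro n x
    rfl
  inv_mem' := by
    intro a ha n x
    have h := ha n ((a (n + 1)).symm x)
    rw [Equiv.apply_symm_apply] at h
    exact (Equiv.symm_apply_eq (a n)).2 h |>.symm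

/-- `π_n : Aut T → Sym(f⁻ⁿ(β))`, the action on the `n`-th level. -/
def levelAction (f : RatFunc K) (β : Ω) (n : ℕ) :
    treeAut f β →* Equiv.Perm (Level f β n) :=
  (Pi.evalMonoidHom (fun n => Equiv.Perm (Level f β n)) n).comp (treeAut f β).subtype

/-- `π_n(G)`, for a subgroup `G` of `Aut T`. -/
def levelGroup {f : RatFunc K} {β : Ω} (G : Subgroup (treeAut f β)) (n : ℕ) :
    Subgroup (Equiv.Perm (Level f β n)) :=
  G.map (levelAction f β n)

/-- The proportion of the elements of `π_n(G)` that fix a vertex at level `n`. -/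
noncomputable def fixedProportion {f : RatFunc K} {β : Ω} (G : Subgroup (treeAut f β))
    (n : ℕ) : ℝ :=
  (Nat.card {g : levelGroup G n // ∃ v : Level f β n, g.1 v = v} : ℝ) /
    (Nat.card (levelGroup G n) : ℝ)

/-- The fixed-point proportion `FPP(G)`, the limit of `fixedProportion G n` as `n → ∞`. -/
noncomputable def FPP {f : RatFunc K} {β : Ω} (G : Subgroup (treeAut f β)) : ℝ :=
  limUnder atTop (fixedProportion G)

end Tree

section Galois

variable {K : Type*} [Field K] {F : Type*} [Field F] [Algebra K F]
  {Ω : Type*} [Field Ω] [Algebra K Ω] [Algebra F Ω] [IsScalarTower K F Ω]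

theorem aeval_algEquiv (σ : Ω ≃ₐ[F] Ω) (p : Polynomial K) (a : Ω) :
    Polynomial.aeval (σ a) p = σ (Polynomial.aeval a p) :=
  Polynomial.aeval_algHom_apply (σ.restrictScalars K : Ω ≃ₐ[K] Ω).toAlgHom a p

theorem map_ratMap (f : RatFunc K) (σ : Ω ≃ₐ[F] Ω) (x : OnePoint Ω) :
    OnePoint.map σ (ratMap f Ω x) = ratMap f Ω (OnePoint.map σ x) := by
  have hK (k : K) : σ (algebraMap K Ω k) = algebraMap K Ω k :=
    (σ.restrictScalars K).commutes k
  induction x using OnePoint.rec with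
  | infty =>
    rw [OnePoint.map_infty]
    simp only [ratMap]
    split_ifs
    · rfl
    · exact congrArg OnePoint.some (hK _)
  | coe a =>
    rw [OnePoint.map_some]
    simp only [ratMap]
    by_cases h : Polynomial.aeval a f.denom = 0
    · have h' : Polynomial.aeval (σ a) f.denom = 0 := by rw [aeval_algEquiv, h, map_zero]
      rw [if_pos h, if_pos h', OnePoint.map_infty]
    · have h' : Polynomial.aeval (σ a) f.denom ≠ 0 := by
        rw [aeval_algEquiv]
        exact (map_ne_zero σ).2 h
      rw [if_neg h, if_neg h', OnePoint.map_some, map_div₀, aeval_algEquiv, aeval_algEquiv]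

theorem map_iterate_ratMap (f : RatFunc K) (σ : Ω ≃ₐ[F] Ω) (n : ℕ) (x : OnePoint Ω) :
    OnePoint.map σ ((ratMap f Ω)^[n] x) = (ratMap f Ω)^[n] (OnePoint.map σ x) :=
  Function.Semiconj.iterate_right (map_ratMap f σ) n x

/-- The action of `σ ∈ Gal(Ω/F)` on the preimages `f⁻ⁿ(β)` of `β ∈ F`. -/
noncomputable def galoisLevel (f : RatFunc K) (β : F) (n : ℕ) (σ : Ω ≃ₐ[F] Ω)
    (x : Level f (algebraMap F Ω β) n) : Level f (algebraMap F Ω β) n :=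
  ⟨OnePoint.map σ x.1, by
    rw [← map_iterate_ratMap, x.2]
    exact congrArg OnePoint.some (σ.commutes β)⟩

theorem galoisLevel_mul (f : RatFunc K) (β : F) (n : ℕ) (σ τ : Ω ≃ₐ[F] Ω)
    (x : Level f (algebraMap F Ω β) n) :
    galoisLevel f β n (σ * τ) x = galoisLevel f β n σ (galoisLevel f β n τ x) := by
  obtain ⟨x, hx⟩ := x
  apply Subtype.ext
  induction x using OnePoint.rec <;> rfl

theorem galoisLevel_one (f : RatFunc K) (β : F) (n : ℕ)
    (x : Level f (algebraMap F Ω β) n) : galoisLevel f β n (1 : Ω ≃ₐ[F] Ω) x = x := by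
  obtain ⟨x, hx⟩ := x
  apply Subtype.ext
  induction x using OnePoint.rec <;> rfl

variable (Ω) in
/-- The arboreal Galois representation `ρ : Gal(Ω/F) → Aut T` on the tree of preimages of
`β ∈ F`. -/
noncomputable def arborealRep (f : RatFunc K) (β : F) :
    (Ω ≃ₐ[F] Ω) →* treeAut f (algebraMap F Ω β) where
  toFun σ :=
    ⟨fun n =>
      { toFun := galoisLevel f β n σ
        invFun := galoisLevel f β n σ⁻¹
        left_inv := fun x => by rw [← galoisLevel_mul, inv_mul_cancel, galoisLevel_one]
        right_inv := fun x => by rw [← galoisLevel_mul, mul_inv_cancel, galoisLevel_one] },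
      fun n x => Subtype.ext (map_ratMap f σ x.1).symm⟩
  map_one' := by
    apply Subtype.ext
    funext n
    exact Equiv.ext fun x => galoisLevel_one f β n x
  map_mul' σ τ := by
    apply Subtype.ext
    funext n
    exact Equiv.ext fun x => galoisLevel_mul f β n σ τ x

variable (Ω) in
/-- `ρ(Gal(Ω/F))`. For `Ω` a separable closure of `F`, this is `G_∞(K, f, t)` if `F = K(t)` and
`β = t`, and it is the specialization `G_∞(K, f, α)` if `F = K` and `β = α`. -/
noncomputable def arithmeticGroup (f : RatFunc K) (β : F) :
    Subgroup (treeAut f (algebraMap F Ω β)) :=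
  (arborealRep Ω f β).range

variable (Ω) in
/-- `ρ(Gal(Ω/F(Kˢᵉᵖ)))`, where `Kˢᵉᵖ` is the separable closure of `K` in `Ω`. For `Ω` a separable
closure of `F = K(t)` and `β = t`, this is the geometric group `G_∞(Kˢᵉᵖ, f, t)`. -/
noncomputable def geometricGroup (f : RatFunc K) (β : F) :
    Subgroup (treeAut f (algebraMap F Ω β)) :=
  (IntermediateField.adjoin F (separableClosure K Ω : Set Ω)).fixingSubgroup.map
    (arborealRep Ω f β)

end Galois

section Monodromy

variable {K : Type*} [Field K] (f : RatFunc K) (Ω : Type*) [Field Ω] [Algebra K Ω]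
  [Algebra (RatFunc K) Ω] [IsScalarTower K (RatFunc K) Ω]

/-- `π_1(G_∞(K, f, t)) ≤ Sym(f⁻¹(t))`, where `K(t) = RatFunc K` and `t = RatFunc.X`. -/
noncomputable abbrev arithmeticMonodromy :
    Subgroup (Equiv.Perm (Level f (algebraMap (RatFunc K) Ω RatFunc.X) 1)) :=
  levelGroup (arithmeticGroup Ω f (RatFunc.X : RatFunc K)) 1

/-- `π_1(G_∞(Kˢᵉᵖ, f, t))`, a normal subgroup of `π_1(G_∞(K, f, t))`. -/
noncomputable abbrev geometricMonodromy :
    Subgroup (Equiv.Perm (Level f (algebraMap (RatFunc K) Ω RatFunc.X) 1)) :=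
  levelGroup (geometricGroup Ω f (RatFunc.X : RatFunc K)) 1

/-- `Q = π_1(G_∞(K, f, t)) / π_1(G_∞(Kˢᵉᵖ, f, t))`, the set of cosets. -/
abbrev MonodromyQuotient : Type _ :=
  arithmeticMonodromy f Ω ⧸ (geometricMonodromy f Ω).subgroupOf (arithmeticMonodromy f Ω)

/-- `M` is a non-empty set of cosets in `Q`, and every element of every coset in `M` fixes some
point of `f⁻¹(t)` (the point may depend on the element). Thus `f` has bad monodromy if and only if
such an `M` exists. -/
def IsBadMonodromySet (M : Set (MonodromyQuotient f Ω)) : Prop :=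
  M.Nonempty ∧ ∀ g : arithmeticMonodromy f Ω, (g : MonodromyQuotient f Ω) ∈ M →
    ∃ v : Level f (algebraMap (RatFunc K) Ω RatFunc.X) 1, g.1 v = v

end Monodromy

end IteratedGalois

open IteratedGalois

namespace IteratedGalois

/-! ### Counting in finite groups and their quotients. -/

section Counting

/-! The point is that an automorphism whose coset lies in `M` fixes a vertex on every level, not
only on the first. The coset of `σ` in `Q` is determined by the restriction of `σ` to `Kˢᵉᵖ`
(`mk_toMonodromy_eq`). Let `σ` fix `x ∈ f⁻¹(t)`. Since `x` is transcendental and `t ∈ K(x)`, the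
field `Ω` is a separable closure of both `Kˢᵉᵖ(t)` and `Kˢᵉᵖ(x)`, so some automorphism `φ` of `Ω`
over `Kˢᵉᵖ` sends `t` to `x` (`exists_algEquiv_separableClosure`). The conjugate `φ⁻¹σφ` fixes `t`
and agrees with `σ` on `Kˢᵉᵖ`, hence has the same coset. By induction it fixes some `y ∈ f⁻ⁿ(t)`,
and then `σ` fixes `φ(y) ∈ f⁻⁽ⁿ⁺¹⁾(t)` (`exists_fixed_of_forall_eqOn`).

The rest for `t` is counting. A fixed vertex has a fixed parent, so the proportions decrease and
converge (`fixedProportion_antitone`). From level 1 on they are at least the density of the cosets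
in `M`, which is `#M / |Q|` (`le_fixedProportion`).

For `α`, a place of `Ω` above `t = α` reduces the tree of `t` to the tree of `α`. On finitely many
points, each `σ ∈ Gal(Kˢᵉᵖ/K)` is matched under reduction by some `τ ∈ Gal(Ω/K(t))`
(`exists_algEquiv_reduction_eq`). Two points of `f⁻¹(t)` with the same reduction would create a
critical point above `α` (`two_le_ramificationIndex_reduction`), so reduction is injective on level
1. It therefore embeds the first-level group of `α` in that of `t`, and equality of orders makes
this an isomorphism. If the image of `σ` lies over `M`, then `τ` fixes a vertex at level `n`, whose
reduction is fixed by `σ`. -/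

theorem card_preimage_mul_card {P Q : Type*} [Group P] [Group Q] [Finite P] (φ : P →* Q)
    (hφ : Function.Surjective φ) (T : Set Q) :
    Nat.card (φ ⁻¹' T) * Nat.card Q = Nat.card T * Nat.card P := by
  classical
  have : Finite Q := Finite.of_surjective φ hφ
  -- All fibres of `φ` are cosets of the kernel, hence of equal size.
  have key (S : Set Q) : Nat.card (φ ⁻¹' S) = Nat.card φ.ker * Nat.card S := by
    have h1 : φ ⁻¹' S = QuotientGroup.mk (s := φ.ker) ⁻¹'
        ((QuotientGroup.quotientKerEquivOfSurjective φ hφ) ⁻¹' S) := rfl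
    rw [h1, Nat.card_congr (QuotientGroup.preimageMkEquivSubgroupProdSet _ _), Nat.card_prod]
    congr 1
    exact Nat.card_congr ((QuotientGroup.quotientKerEquivOfSurjective φ hφ).toEquiv.subtypeEquiv
      fun _ => Iff.rfl)
  have h2 := key Set.univ
  rw [Set.preimage_univ, Nat.card_univ, Nat.card_univ] at h2
  rw [key T, h2]
  ring

theorem ncard_div_card_quotient {P : Type*} [Group P] [Finite P] (H : Subgroup P)
    (M : Set (P ⧸ H)) :
    (M.ncard : ℝ) / Nat.card (P ⧸ H) =
      (Nat.card (QuotientGroup.mk (s := H) ⁻¹' M) : ℝ) / Nat.card P := by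
  rw [Nat.card_congr (QuotientGroup.preimageMkEquivSubgroupProdSet _ _), Nat.card_prod,
    H.card_eq_card_quotient_mul_card_subgroup, Nat.card_coe_set_eq]
  have h1 : (Nat.card H : ℝ) ≠ 0 := by exact_mod_cast Nat.card_pos.ne'
  push_cast
  rw [mul_comm (Nat.card H : ℝ), mul_div_mul_right _ _ h1]

/-- Provides the restriction maps between the finite groups `π_n(G)`, once a trivial action on one
level is known to force a trivial action on another. -/
theorem exists_hom_map_of_ker_le {Γ X Y : Type*} [Group Γ] [Group X] [Group Y] (G : Subgroup Γ)
    (a : Γ →* X) (b : Γ →* Y) (h : ∀ g, a g = 1 → b g = 1) :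
    ∃ φ : G.map a →* G.map b, Function.Surjective φ ∧
      ∀ g (hg : g ∈ G), φ ⟨a g, Subgroup.mem_map_of_mem a hg⟩ =
        ⟨b g, Subgroup.mem_map_of_mem b hg⟩ := by
  have ha := a.subgroupMap_surjective G
  have hk : (a.subgroupMap G).ker ≤ (b.subgroupMap G).ker := by
    intro g hg
    rw [MonoidHom.mem_ker] at hg ⊢
    exact Subtype.ext (h g (congrArg Subtype.val hg))
  have key (g : G) : (a.subgroupMap G).liftOfSurjective ha ⟨b.subgroupMap G, hk⟩
      (a.subgroupMap G g) = b.subgroupMap G g :=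
    MonoidHom.liftOfRightInverse_comp_apply _ _ (Function.rightInverse_surjInv ha)
      ⟨b.subgroupMap G, hk⟩ g
  refine ⟨(a.subgroupMap G).liftOfSurjective ha ⟨b.subgroupMap G, hk⟩, ?_, fun g hg => key ⟨g, hg⟩⟩
  intro y
  obtain ⟨g, rfl⟩ := b.subgroupMap_surjective G y
  exact ⟨_, key g⟩

end Counting

/-! ### Fixed-point proportions along the levels of the tree. -/

section FixedPoints

variable {K : Type*} [Field K] {Ω : Type*} [Field Ω] [Algebra K Ω] {f : RatFunc K} {β : Ω}

theorem levelAction_mem_levelGroup {G : Subgroup (treeAut f β)} {g : treeAut f β} (hg : g ∈ G)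
    (n : ℕ) : levelAction f β n g ∈ levelGroup G n :=
  Subgroup.mem_map_of_mem _ hg

theorem exists_levelGroup_hom (G : Subgroup (treeAut f β)) (n m : ℕ)
    (h : ∀ g, levelAction f β n g = 1 → levelAction f β m g = 1) :
    ∃ φ : levelGroup G n →* levelGroup G m, Function.Surjective φ ∧
      ∀ g (hg : g ∈ G), φ ⟨levelAction f β n g, levelAction_mem_levelGroup hg n⟩ =
        ⟨levelAction f β m g, levelAction_mem_levelGroup hg m⟩ :=
  exists_hom_map_of_ker_le G _ _ h

theorem levelAction_eq_one_of_succ {n : ℕ} (hs : Function.Surjective (parent f β n))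
    (g : treeAut f β) (hg : levelAction f β (n + 1) g = 1) : levelAction f β n g = 1 := by
  ext1 y
  obtain ⟨x, rfl⟩ := hs y
  have h1 := g.2 n x
  have h2 : g.1 (n + 1) x = x := congrArg (fun e => e x) hg
  rw [h2] at h1
  exact h1.symm

theorem levelAction_one_eq_one (hs : ∀ n, Function.Surjective (parent f β n)) (n : ℕ)
    (g : treeAut f β) (hg : levelAction f β (n + 1) g = 1) : levelAction f β 1 g = 1 := by
  induction n with
  | zero => exact hg
  | succ n ih => exact ih (levelAction_eq_one_of_succ (hs _) g hg)

/-- The parent of a fixed vertex is fixed, so the elements counted at level `n + 1` lie over those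
counted at level `n`; restriction is onto with fibres of equal size, so it preserves densities. -/
theorem fixedProportion_antitone (hfin : ∀ n, Finite (Level f β n))
    (hs : ∀ n, Function.Surjective (parent f β n)) (G : Subgroup (treeAut f β)) :
    Antitone (fixedProportion G) := by
  refine antitone_nat_of_succ_le fun n => ?_
  have := hfin n
  have := hfin (n + 1)
  obtain ⟨φ, hφ, hφg⟩ := exists_levelGroup_hom G (n + 1) n
    (levelAction_eq_one_of_succ (hs n))
  have hc := card_preimage_mul_card (P := levelGroup G (n + 1)) (Q := levelGroup G n) φ hφ
    {g | ∃ v : Level f β n, g.1 v = v}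
  have hle : Nat.card {g : levelGroup G (n + 1) // ∃ v : Level f β (n + 1), g.1 v = v} ≤
      Nat.card (φ ⁻¹' {g | ∃ v : Level f β n, g.1 v = v}) := by
    refine Nat.card_mono (Set.toFinite _) ?_
    rintro ⟨_, g, hg, rfl⟩ ⟨v, hv⟩
    refine ⟨parent f β n v, ?_⟩
    change (φ ⟨levelAction f β (n + 1) g, levelAction_mem_levelGroup hg (n + 1)⟩).1 _ = _
    rw [hφg g hg]
    have h1 := g.2 n v
    have h2 : g.1 (n + 1) v = v := hv
    rw [h2] at h1
    exact h1.symm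
  have p1 : (0 : ℝ) < Nat.card (levelGroup G (n + 1)) := by exact_mod_cast Nat.card_pos
  have p2 : (0 : ℝ) < Nat.card (levelGroup G n) := by exact_mod_cast Nat.card_pos
  rw [fixedProportion, fixedProportion, div_le_div_iff₀ p1 p2]
  have hle' := Nat.mul_le_mul_right (Nat.card (levelGroup G n)) hle
  exact_mod_cast hle'.trans_eq hc

/-- Pulling `M` back to `π_{n+1}(G)` preserves its density, and the pullback consists of elements
with a fixed vertex. The map `ψ` is the identity for the tree of `t` and the transport from level 1
of the specialized tree for `α`. Level 0 is excluded because it does not determine the action on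
level 1. -/
theorem le_fixedProportion {P : Type*} [Group P] [Finite P] (H : Subgroup P) (M : Set (P ⧸ H))
    (hfin : ∀ n, Finite (Level f β n)) (hs : ∀ n, Function.Surjective (parent f β n))
    (G : Subgroup (treeAut f β)) (ψ : levelGroup G 1 →* P) (hψ : Function.Surjective ψ)
    (hfix : ∀ g (hg : g ∈ G),
      (ψ ⟨levelAction f β 1 g, levelAction_mem_levelGroup hg 1⟩ : P ⧸ H) ∈ M →
      ∀ n, ∃ v, levelAction f β n g v = v) (n : ℕ) :
    (M.ncard : ℝ) / Nat.card (P ⧸ H) ≤ fixedProportion G (n + 1) := by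
  have := hfin (n + 1)
  obtain ⟨φ, hφ, hφg⟩ := exists_levelGroup_hom G (n + 1) 1
    (levelAction_one_eq_one hs n)
  have hc := card_preimage_mul_card (P := levelGroup G (n + 1)) (ψ.comp φ)
    (hψ.comp hφ) (QuotientGroup.mk (s := H) ⁻¹' M)
  have hle : Nat.card (ψ.comp φ ⁻¹' (QuotientGroup.mk (s := H) ⁻¹' M)) ≤
      Nat.card {g : levelGroup G (n + 1) // ∃ v : Level f β (n + 1), g.1 v = v} := by
    refine Nat.card_mono (Set.toFinite _) ?_
    rintro ⟨_, g, hg, rfl⟩ hv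
    refine hfix g hg ?_ (n + 1)
    have hv' : (ψ (φ ⟨levelAction f β (n + 1) g, levelAction_mem_levelGroup hg (n + 1)⟩) :
      P ⧸ H) ∈ M := hv
    rwa [hφg g hg] at hv'
  have p1 : (0 : ℝ) < Nat.card (levelGroup G (n + 1)) := by exact_mod_cast Nat.card_pos
  have p2 : (0 : ℝ) < Nat.card P := by exact_mod_cast Nat.card_pos
  rw [ncard_div_card_quotient, fixedProportion, div_le_div_iff₀ p2 p1]
  have hle' := Nat.mul_le_mul_right (Nat.card P) hle
  exact_mod_cast hc.symm.trans_le hle'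

theorem tendsto_FPP_and_le (hfin : ∀ n, Finite (Level f β n))
    (hs : ∀ n, Function.Surjective (parent f β n)) (G : Subgroup (treeAut f β)) (c : ℝ)
    (hc : ∀ n, c ≤ fixedProportion G (n + 1)) :
    Tendsto (fixedProportion G) atTop (𝓝 (FPP G)) ∧ c ≤ FPP G := by
  have hb : BddBelow (Set.range (fixedProportion G)) :=
    ⟨0, by rintro _ ⟨n, rfl⟩; exact div_nonneg (Nat.cast_nonneg _) (Nat.cast_nonneg _)⟩
  have ht : Tendsto (fixedProportion G) atTop (𝓝 (FPP G)) :=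
    tendsto_nhds_limUnder ⟨_, tendsto_atTop_ciInf (fixedProportion_antitone hfin hs G) hb⟩
  exact ⟨ht, ge_of_tendsto' ((tendsto_add_atTop_iff_nat 1).2 ht) hc⟩

end FixedPoints

theorem onePointMap_injective {X Y : Type*} {g : X → Y} (hg : Function.Injective g) :
    Function.Injective (OnePoint.map g) :=
  Option.map_injective hg

/-! ### Rational maps in homogeneous coordinates. -/

section Homogeneous

variable {K : Type*} [Field K]

/-- The value at `(u, v)` of the binary form of degree `d` obtained by homogenizing `p`. -/
noncomputable def homEval (p : Polynomial K) (d : ℕ) {R : Type*} [CommRing R] [Algebra K R]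
    (u v : R) : R :=
  ∑ i ∈ Finset.range (d + 1), algebraMap K R (p.coeff i) * u ^ i * v ^ (d - i)

open Classical in
/-- The point `[u : v]` of the projective line. -/
noncomputable def projPoint {A : Type*} [Field A] (u v : A) : OnePoint A :=
  if v = 0 then OnePoint.infty else OnePoint.some (u / v)

theorem map_homEval (p : Polynomial K) (d : ℕ) {R S : Type*} [CommRing R] [Algebra K R]
    [CommRing S] [Algebra K S] (φ : R →ₐ[K] S) (u v : R) :
    φ (homEval p d u v) = homEval p d (φ u) (φ v) := by
  simp [homEval, map_sum]

theorem homEval_zero_right (p : Polynomial K) (d : ℕ) {R : Type*} [CommRing R] [Algebra K R]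
    (u : R) : homEval p d u 0 = algebraMap K R (p.coeff d) * u ^ d := by
  rw [homEval, Finset.sum_range_succ, Finset.sum_eq_zero, zero_add, Nat.sub_self, pow_zero, mul_one]
  intro i hi
  rw [zero_pow (Nat.sub_ne_zero_of_lt (Finset.mem_range.1 hi)), mul_zero]

theorem homEval_of_ne_zero {p : Polynomial K} {d : ℕ} (hd : p.natDegree ≤ d) {A : Type*} [Field A]
    [Algebra K A] (u : A) {v : A} (hv : v ≠ 0) :
    homEval p d u v = v ^ d * Polynomial.aeval (u / v) p := by
  rw [Polynomial.aeval_eq_sum_range' (Nat.lt_succ_of_le hd), homEval, Finset.mul_sum]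
  refine Finset.sum_congr rfl fun i hi => ?_
  have h : v ^ d = v ^ (d - i) * v ^ i := by
    rw [← pow_add, Nat.sub_add_cancel (Nat.lt_succ_iff.1 (Finset.mem_range.1 hi))]
  rw [Algebra.smul_def, h, div_pow]
  field_simp

theorem natDegree_num_le_ratDegree (f : RatFunc K) : f.num.natDegree ≤ ratDegree f := le_max_left _ _

theorem natDegree_denom_le_ratDegree (f : RatFunc K) : f.denom.natDegree ≤ ratDegree f :=
  le_max_right _ _

theorem coeff_ratDegree_ne_zero (f : RatFunc K) :
    f.num.coeff (ratDegree f) ≠ 0 ∨ f.denom.coeff (ratDegree f) ≠ 0 := by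
  by_cases h : f.denom.natDegree = ratDegree f
  · right
    rw [← h]
    exact Polynomial.leadingCoeff_ne_zero.2 f.denom_ne_zero
  · left
    have h1 : f.num.natDegree = ratDegree f := by
      have := natDegree_denom_le_ratDegree f
      unfold ratDegree at *
      omega
    have h2 : f.num ≠ 0 := by
      intro h0
      have h3 := natDegree_denom_le_ratDegree f
      rw [h0, Polynomial.natDegree_zero] at h1
      omega
    rw [← h1]
    exact Polynomial.leadingCoeff_ne_zero.2 h2

variable {A : Type*} [Field A] [Algebra K A]

theorem aeval_num_or_denom_ne_zero (f : RatFunc K) (a : A) :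
    Polynomial.aeval a f.num ≠ 0 ∨ Polynomial.aeval a f.denom ≠ 0 := by
  by_contra! h
  obtain ⟨r, s, hrs⟩ := f.isCoprime_num_denom
  have := congrArg (Polynomial.aeval a) hrs
  simp [h.1, h.2] at this

theorem homEval_num_or_denom_ne_zero (f : RatFunc K) {u v : A} (h : u ≠ 0 ∨ v ≠ 0) :
    homEval f.num (ratDegree f) u v ≠ 0 ∨ homEval f.denom (ratDegree f) u v ≠ 0 := by
  by_cases hv : v = 0
  · subst hv
    have hu : u ≠ 0 := by simpa using h
    simp only [homEval_zero_right]
    refine (coeff_ratDegree_ne_zero f).imp ?_ ?_ <;>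
    · intro h
      exact mul_ne_zero ((map_ne_zero _).2 h) (pow_ne_zero _ hu)
  · rw [homEval_of_ne_zero (natDegree_num_le_ratDegree f) u hv,
      homEval_of_ne_zero (natDegree_denom_le_ratDegree f) u hv]
    exact (aeval_num_or_denom_ne_zero f (u / v)).imp (mul_ne_zero (pow_ne_zero _ hv))
      (mul_ne_zero (pow_ne_zero _ hv))

/-- Replaces the case distinctions at poles and at `∞` by two forms without common zero. This makes
compatibility with field embeddings and with reduction a formal matter. -/
theorem ratMap_projPoint (f : RatFunc K) {u v : A} (h : u ≠ 0 ∨ v ≠ 0) :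
    ratMap f A (projPoint u v) =
      projPoint (homEval f.num (ratDegree f) u v) (homEval f.denom (ratDegree f) u v) := by
  by_cases hv : v = 0
  · subst hv
    have hu : u ^ ratDegree f ≠ 0 := pow_ne_zero _ (by simpa using h)
    by_cases hd : f.denom.coeff (ratDegree f) = 0
    · simp [projPoint, ratMap, homEval_zero_right, hd]
    · have hd' : algebraMap K A (f.denom.coeff (ratDegree f)) * u ^ ratDegree f ≠ 0 :=
        mul_ne_zero ((map_ne_zero _).2 hd) hu
      rw [homEval_zero_right, homEval_zero_right, projPoint, if_pos rfl, projPoint, if_neg hd']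
      simp only [ratMap]
      rw [if_neg hd, mul_div_mul_right _ _ hu, map_div₀]
  · have hv' : v ^ ratDegree f ≠ 0 := pow_ne_zero _ hv
    rw [homEval_of_ne_zero (natDegree_num_le_ratDegree f) u hv,
      homEval_of_ne_zero (natDegree_denom_le_ratDegree f) u hv]
    by_cases hd : Polynomial.aeval (u / v) f.denom = 0
    · simp [projPoint, ratMap, hv, hd]
    · rw [projPoint, if_neg hv, projPoint, if_neg (mul_ne_zero hv' hd)]
      simp only [ratMap]
      rw [if_neg hd, mul_div_mul_left _ _ hv']

theorem map_projPoint {B : Type*} [Field B] (φ : A →+* B) (u v : A) :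
    OnePoint.map φ (projPoint u v) = projPoint (φ u) (φ v) := by
  by_cases hv : v = 0
  · simp [projPoint, hv]
  · simp [projPoint, hv]

theorem exists_projPoint (x : OnePoint A) : ∃ u v : A, (u ≠ 0 ∨ v ≠ 0) ∧ x = projPoint u v := by
  induction x using OnePoint.rec with
  | infty => exact ⟨1, 0, Or.inl one_ne_zero, by simp [projPoint]⟩
  | coe a => exact ⟨a, 1, Or.inr one_ne_zero, by simp [projPoint]⟩

theorem ratMap_map {B : Type*} [Field B] [Algebra K B] (f : RatFunc K) (φ : A →ₐ[K] B)
    (x : OnePoint A) : ratMap f B (OnePoint.map φ x) = OnePoint.map φ (ratMap f A x) := by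
  obtain ⟨u, v, h, rfl⟩ := exists_projPoint x
  have h' : φ u ≠ 0 ∨ φ v ≠ 0 := by simpa using h
  have hm (a b : A) : OnePoint.map φ (projPoint a b) = projPoint (φ a) (φ b) :=
    map_projPoint (φ : A →+* B) a b
  rw [ratMap_projPoint f h, hm, hm, ratMap_projPoint f h', map_homEval, map_homEval]

theorem iterate_ratMap_map {B : Type*} [Field B] [Algebra K B] (f : RatFunc K) (φ : A →ₐ[K] B)
    (n : ℕ) (x : OnePoint A) :
    (ratMap f B)^[n] (OnePoint.map φ x) = OnePoint.map φ ((ratMap f A)^[n] x) :=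
  (Function.Semiconj.iterate_right (fun x => (ratMap_map f φ x).symm) n x).symm

end Homogeneous

/-! ### Fibres of a rational map as zeros of binary forms. -/

section Fibers

variable {K : Type*} [Field K] {A : Type*} [Field A] [Algebra K A] (f : RatFunc K)

theorem ratMap_coe_eq_iff (a : A) (b : OnePoint A) :
    ratMap f A (OnePoint.some a) = b ↔ (fiberPoly f A b).eval a = 0 := by
  induction b using OnePoint.rec with
  | infty =>
    simp only [ratMap, fiberPoly, Polynomial.eval_map_algebraMap]
    by_cases h : Polynomial.aeval a f.denom = 0 <;> simp [h]
  | coe b =>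
    simp only [ratMap, fiberPoly, Polynomial.eval_sub, Polynomial.eval_mul, Polynomial.eval_C,
      Polynomial.eval_map_algebraMap]
    by_cases h : Polynomial.aeval a f.denom = 0
    · have := aeval_num_or_denom_ne_zero f a
      simp only [h, if_true, mul_zero, sub_zero]
      simpa [h] using this
    · rw [if_neg h, OnePoint.coe_eq_coe, div_eq_iff h, sub_eq_zero]

/-- A binary form of degree `d` vanishes at `∞ = [1 : 0]` exactly when its coefficient of index `d`
does. -/
theorem ratMap_infty_eq_iff (b : OnePoint A) :
    ratMap f A OnePoint.infty = b ↔ (fiberPoly f A b).coeff (ratDegree f) = 0 := by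
  induction b using OnePoint.rec with
  | infty =>
    simp only [ratMap, fiberPoly, Polynomial.coeff_map, map_eq_zero]
    by_cases h : f.denom.coeff (ratDegree f) = 0 <;> simp [h]
  | coe b =>
    simp only [ratMap, fiberPoly, Polynomial.coeff_sub, Polynomial.coeff_C_mul,
      Polynomial.coeff_map]
    by_cases h : f.denom.coeff (ratDegree f) = 0
    · have := coeff_ratDegree_ne_zero f
      simp only [h, if_true, mul_zero, sub_zero, map_zero]
      simpa [h] using this
    · have h' : algebraMap K A (f.denom.coeff (ratDegree f)) ≠ 0 := (map_ne_zero _).2 h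
      rw [if_neg h, OnePoint.coe_eq_coe, map_div₀, div_eq_iff h', sub_eq_zero]

theorem natDegree_fiberPoly_le (b : OnePoint A) :
    (fiberPoly f A b).natDegree ≤ ratDegree f := by
  induction b using OnePoint.rec with
  | infty =>
    exact (Polynomial.natDegree_map_le).trans (natDegree_denom_le_ratDegree f)
  | coe b =>
    refine (Polynomial.natDegree_sub_le _ _).trans (max_le ?_ ?_)
    · exact (Polynomial.natDegree_map_le).trans (natDegree_num_le_ratDegree f)
    · exact (Polynomial.natDegree_C_mul_le _ _).trans
        ((Polynomial.natDegree_map_le).trans (natDegree_denom_le_ratDegree f))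

variable {f}

/-- If `p = b q`, then coprimality makes `q` a unit, so `f` would be constant. -/
theorem fiberPoly_ne_zero (hf : 2 ≤ ratDegree f) (b : OnePoint A) : fiberPoly f A b ≠ 0 := by
  induction b using OnePoint.rec with
  | infty =>
    exact (Polynomial.map_ne_zero_iff (algebraMap K A).injective).2 f.denom_ne_zero
  | coe b =>
    intro h
    have h1 : f.num.map (algebraMap K A) = Polynomial.C b * f.denom.map (algebraMap K A) :=
      sub_eq_zero.1 h
    have hc : IsCoprime (f.num.map (algebraMap K A)) (f.denom.map (algebraMap K A)) :=
      f.isCoprime_num_denom.map (Polynomial.mapRingHom (algebraMap K A))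
    have hu : IsUnit (f.denom.map (algebraMap K A)) :=
      hc.isUnit_of_dvd' (h1 ▸ dvd_mul_left _ _) dvd_rfl
    have hd := Polynomial.natDegree_eq_zero_of_isUnit hu
    have hn : (f.num.map (algebraMap K A)).natDegree = 0 := by
      have := Polynomial.natDegree_C_mul_le b (f.denom.map (algebraMap K A))
      rw [h1]
      omega
    rw [Polynomial.natDegree_map] at hd hn
    simp [ratDegree, hd, hn] at hf

theorem finite_ratMap_fiber (hf : 2 ≤ ratDegree f) (b : OnePoint A) :
    (ratMap f A ⁻¹' {b}).Finite := by
  classical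
  refine (((fiberPoly f A b).roots.toFinset.finite_toSet.image OnePoint.some).union
    (Set.finite_singleton OnePoint.infty)).subset ?_
  intro x hx
  induction x using OnePoint.rec with
  | infty => exact Or.inr rfl
  | coe a =>
    left
    refine ⟨a, ?_, rfl⟩
    rw [Finset.mem_coe, Multiset.mem_toFinset, Polynomial.mem_roots (fiberPoly_ne_zero hf b)]
    exact (ratMap_coe_eq_iff f a b).1 hx

theorem finite_level (hf : 2 ≤ ratDegree f) (β : A) (n : ℕ) : Finite (Level f β n) := by
  have key : ((ratMap f A)^[n] ⁻¹' {OnePoint.some β}).Finite := by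
    induction n with
    | zero => exact Set.finite_singleton _
    | succ n ih =>
      rw [Function.iterate_succ, Set.preimage_comp]
      exact ih.preimage' fun b _ => finite_ratMap_fiber hf b
  exact key.to_subtype

theorem ratMap_surjective [IsAlgClosed A] (hf : 2 ≤ ratDegree f) :
    Function.Surjective (ratMap f A) := by
  intro b
  by_cases h : (fiberPoly f A b).natDegree = 0
  · exact ⟨OnePoint.infty, (ratMap_infty_eq_iff f b).2
      (Polynomial.coeff_eq_zero_of_natDegree_lt (by omega))⟩
  · obtain ⟨a, ha⟩ := IsAlgClosed.exists_root (fiberPoly f A b)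
      (fun h' => h (Polynomial.natDegree_eq_of_degree_eq_some h'))
    exact ⟨OnePoint.some a, (ratMap_coe_eq_iff f a b).2 ha⟩

end Fibers

/-! ### Self-similarity: moving `t` to one of its iterated preimages. -/

section SelfSimilarity

variable {K : Type*} [Field K]

theorem aeval_mem_of_mem {A : Type*} [Field A] [Algebra K A] (S : IntermediateField K A) {a : A}
    (ha : a ∈ S) (p : Polynomial K) : Polynomial.aeval a p ∈ S := by
  have := Polynomial.aeval_algebraMap_apply A (⟨a, ha⟩ : S) p
  change Polynomial.aeval a p = _ at this
  rw [this]
  exact (Polynomial.aeval (⟨a, ha⟩ : S) p).2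

/-- Used with `S` the algebraic closure of `K` in `Ω`, to see that preimages of `t` are finite and
transcendental, and with `S = Kˢᵉᵖ(x)`, to see that it contains `t`. -/
theorem mem_of_iterate_ratMap_eq {A : Type*} [Field A] [Algebra K A] (f : RatFunc K)
    (S : IntermediateField K A) (x : OnePoint S) {n : ℕ} {t : A}
    (h : (ratMap f A)^[n] (OnePoint.map S.val x) = OnePoint.some t) : t ∈ S := by
  rw [iterate_ratMap_map f S.val n x] at h
  generalize (ratMap f S)^[n] x = y at h
  induction y using OnePoint.rec with
  | infty => simp at h
  | coe s =>
    rw [OnePoint.map_some, OnePoint.coe_eq_coe] at h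
    exact h ▸ s.2

variable {Ω : Type*} [Field Ω] [Algebra K Ω] [Algebra (RatFunc K) Ω]
  [IsScalarTower K (RatFunc K) Ω]

theorem algebraMap_ratFunc_eq (a : RatFunc K) :
    algebraMap (RatFunc K) Ω a =
      Polynomial.aeval (algebraMap (RatFunc K) Ω RatFunc.X) a.num /
        Polynomial.aeval (algebraMap (RatFunc K) Ω RatFunc.X) a.denom := by
  rw [Polynomial.aeval_algebraMap_apply, Polynomial.aeval_algebraMap_apply,
    RatFunc.aeval_X_left_eq_algebraMap, RatFunc.aeval_X_left_eq_algebraMap, ← map_div₀,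
    RatFunc.num_div_denom]

theorem algebraMap_ratFunc_mem (S : IntermediateField K Ω)
    (h : algebraMap (RatFunc K) Ω RatFunc.X ∈ S) (a : RatFunc K) :
    algebraMap (RatFunc K) Ω a ∈ S := by
  rw [algebraMap_ratFunc_eq]
  exact div_mem (aeval_mem_of_mem S h _) (aeval_mem_of_mem S h _)

theorem algEquiv_commutes_ratFunc (σ : Ω ≃ₐ[K] Ω)
    (h : σ (algebraMap (RatFunc K) Ω RatFunc.X) = algebraMap (RatFunc K) Ω RatFunc.X)
    (a : RatFunc K) : σ (algebraMap (RatFunc K) Ω a) = algebraMap (RatFunc K) Ω a := by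
  have key (p : Polynomial K) (x : Ω) : σ (Polynomial.aeval x p) = Polynomial.aeval (σ x) p :=
    (Polynomial.aeval_algHom_apply (σ : Ω →ₐ[K] Ω) x p).symm
  rw [algebraMap_ratFunc_eq, map_div₀, key, key, h]

variable (K Ω) in
theorem transcendental_algebraMap_X : Transcendental K (algebraMap (RatFunc K) Ω RatFunc.X) :=
  (transcendental_algebraMap_iff (algebraMap (RatFunc K) Ω).injective).2 RatFunc.transcendental_X

theorem exists_eq_coe_of_iterate_ratMap (f : RatFunc K) {n : ℕ} {x : OnePoint Ω}
    (h : (ratMap f Ω)^[n] x = OnePoint.some (algebraMap (RatFunc K) Ω RatFunc.X)) :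
    ∃ a : Ω, x = OnePoint.some a := by
  induction x using OnePoint.rec with
  | infty =>
    have := mem_of_iterate_ratMap_eq f (algebraicClosure K Ω) OnePoint.infty h
    exact absurd (mem_algebraicClosure_iff.1 this) (transcendental_algebraMap_X K Ω)
  | coe a => exact ⟨a, rfl⟩

theorem transcendental_of_iterate_ratMap (f : RatFunc K) {n : ℕ} {x : Ω}
    (h : (ratMap f Ω)^[n] (OnePoint.some x) =
      OnePoint.some (algebraMap (RatFunc K) Ω RatFunc.X)) : Transcendental K x := by
  intro hx
  have := mem_of_iterate_ratMap_eq f (algebraicClosure K Ω)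
    (OnePoint.some ⟨x, mem_algebraicClosure_iff.2 hx⟩) h
  exact transcendental_algebraMap_X K Ω (mem_algebraicClosure_iff.1 this)

/-- Being separably closed does not involve the base field, and separability over `F` passes to the
larger field `E`. -/
theorem isSepClosure_of_le_fieldRange {F E A : Type*} [Field F] [Field E] [Field A] [Algebra F A]
    [Algebra E A] [IsSepClosure F A]
    (h : ∀ a : F, algebraMap F A a ∈ (algebraMap E A).fieldRange) : IsSepClosure E A := by
  let e : E ≃+* (algebraMap E A).fieldRange :=
    RingEquiv.ofBijective (algebraMap E A).rangeRestrictField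
      ⟨(algebraMap E A).rangeRestrictField.injective,
        (algebraMap E A).rangeRestrictField_bijective.2⟩
  let j : F →+* E := e.symm.toRingHom.comp ((algebraMap F A).codRestrict _ h)
  let : Algebra F E := j.toAlgebra
  have : IsScalarTower F E A := by
    refine IsScalarTower.of_algebraMap_eq fun a => ?_
    have : e (e.symm ⟨algebraMap F A a, h a⟩) = ⟨algebraMap F A a, h a⟩ := e.apply_symm_apply _
    exact (congrArg Subtype.val this).symm
  exact ⟨IsSepClosure.sep_closed F, Algebra.isSeparable_tower_top_of_isSeparable F E A⟩

/-- Both `L(x)` and `L(y)` are copies of `L(X)`, and `A` is a separable closure of each. Uniqueness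
of separable closures extends the isomorphism `x ↦ y`. -/
theorem exists_algEquiv_of_transcendental {L F A : Type*} [Field L] [Field F] [Field A]
    [Algebra L A] [Algebra F A] [IsSepClosure F A] {x y : A} (hx : Transcendental L x)
    (hy : Transcendental L y) (hFx : ∀ a : F, algebraMap F A a ∈ IntermediateField.adjoin L {x})
    (hFy : ∀ a : F, algebraMap F A a ∈ IntermediateField.adjoin L {y}) :
    ∃ φ : A ≃ₐ[L] A, φ x = y := by
  let ι (z : A) (hz : Transcendental L z) : RatFunc L →ₐ[L] A :=
    (IntermediateField.val _).comp (RatFunc.algEquivOfTranscendental z hz).toAlgHom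
  have hι (z : A) (hz : Transcendental L z) : ι z hz RatFunc.X = z :=
    RatFunc.algEquivOfTranscendental_X z hz
  have hs (z : A) (hz : Transcendental L z)
      (hF : ∀ a : F, algebraMap F A a ∈ IntermediateField.adjoin L {z}) :
      @IsSepClosure (RatFunc L) _ A _ (ι z hz).toRingHom.toAlgebra := by
    let := (ι z hz).toRingHom.toAlgebra
    refine isSepClosure_of_le_fieldRange (F := F) fun a => ?_
    exact ⟨(RatFunc.algEquivOfTranscendental z hz).symm ⟨_, hF a⟩,
      congrArg Subtype.val ((RatFunc.algEquivOfTranscendental z hz).apply_symm_apply ⟨_, hF a⟩)⟩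
  let φ := @IsSepClosure.equiv (RatFunc L) _ A A _ _ (ι y hy).toRingHom.toAlgebra
    (hs y hy hFy) (ι x hx).toRingHom.toAlgebra (hs x hx hFx)
  have hφ (r : RatFunc L) : φ (ι x hx r) = ι y hy r :=
    @AlgEquiv.commutes (RatFunc L) A A _ _ _ (ι x hx).toRingHom.toAlgebra
      (ι y hy).toRingHom.toAlgebra φ r
  have hL (l : L) : φ (algebraMap L A l) = algebraMap L A l := by
    have := hφ (algebraMap L _ l)
    rwa [(ι x hx).commutes, (ι y hy).commutes] at this
  refine ⟨AlgEquiv.ofRingEquiv (f := @AlgEquiv.toRingEquiv (RatFunc L) A A _ _ _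
    (ι x hx).toRingHom.toAlgebra (ι y hy).toRingHom.toAlgebra φ) hL, ?_⟩
  have := hφ RatFunc.X
  rwa [hι, hι] at this

variable [IsSepClosure (RatFunc K) Ω]

theorem exists_algEquiv_separableClosure (f : RatFunc K) {n : ℕ} {x : Ω}
    (h : (ratMap f Ω)^[n] (OnePoint.some x) =
      OnePoint.some (algebraMap (RatFunc K) Ω RatFunc.X)) :
    ∃ φ : Ω ≃ₐ[separableClosure K Ω] Ω, φ (algebraMap (RatFunc K) Ω RatFunc.X) = x := by
  have mem (z : Ω) :
      z ∈ (IntermediateField.adjoin (separableClosure K Ω) {z}).restrictScalars K :=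
    IntermediateField.mem_adjoin_simple_self _ z
  refine exists_algEquiv_of_transcendental (F := RatFunc K)
    ((transcendental_algebraMap_X K Ω).extendScalars _)
    ((transcendental_of_iterate_ratMap f h).extendScalars _) ?_ ?_
  · exact algebraMap_ratFunc_mem
      ((IntermediateField.adjoin (separableClosure K Ω) {_}).restrictScalars K) (mem _)
  · refine algebraMap_ratFunc_mem
      ((IntermediateField.adjoin (separableClosure K Ω) {x}).restrictScalars K) ?_
    exact mem_of_iterate_ratMap_eq f _ (OnePoint.some ⟨x, mem x⟩) h

/-- The hypothesis depends only on `σ` restricted to `Kˢᵉᵖ`, so it is inherited by the conjugate of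
`σ` to which the induction is applied. -/
theorem exists_fixed_of_forall_eqOn (f : RatFunc K) (σ : Ω ≃ₐ[RatFunc K] Ω)
    (hσ : ∀ τ : Ω ≃ₐ[RatFunc K] Ω, (∀ a ∈ separableClosure K Ω, τ a = σ a) →
      ∃ x, ratMap f Ω x = OnePoint.some (algebraMap (RatFunc K) Ω RatFunc.X) ∧
        OnePoint.map τ x = x) (n : ℕ) :
    ∃ x, (ratMap f Ω)^[n] x = OnePoint.some (algebraMap (RatFunc K) Ω RatFunc.X) ∧
      OnePoint.map σ x = x := by
  induction n generalizing σ with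
  | zero => exact ⟨_, rfl, congrArg OnePoint.some (σ.commutes _)⟩
  | succ n ih =>
    obtain ⟨x, hx, hσx⟩ := hσ σ fun _ _ => rfl
    obtain ⟨x, rfl⟩ := exists_eq_coe_of_iterate_ratMap (n := 1) f hx
    obtain ⟨φ, hφ⟩ := exists_algEquiv_separableClosure (n := 1) f hx
    rw [OnePoint.map_some, OnePoint.coe_eq_coe] at hσx
    let φ' : Ω ≃ₐ[K] Ω := φ.restrictScalars K
    -- Conjugating by `φ` turns the fixed point `x` of `σ` into the fixed point `t` of `φ⁻¹σφ`,
    -- which is therefore `K(t)`-linear.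
    let τ' : Ω ≃ₐ[K] Ω := (φ'.trans (σ.restrictScalars K)).trans φ'.symm
    have hτ' (a : Ω) : τ' a = φ.symm (σ (φ a)) := rfl
    let τ : Ω ≃ₐ[RatFunc K] Ω := AlgEquiv.ofRingEquiv (f := τ'.toRingEquiv)
      (algEquiv_commutes_ratFunc τ' (by rw [hτ', hφ, hσx, ← hφ, AlgEquiv.symm_apply_apply]))
    have hτ (a : Ω) : τ a = φ.symm (σ (φ a)) := rfl
    -- `φ` is the identity on `Kˢᵉᵖ`, and `σ` maps `Kˢᵉᵖ` to itself.
    have hτL (a : Ω) (ha : a ∈ separableClosure K Ω) : τ a = σ a := by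
      have hσa : σ a ∈ separableClosure K Ω := by
        rw [mem_separableClosure_iff] at ha ⊢
        exact (AlgEquiv.isSeparable_iff (σ.restrictScalars K)).2 ha
      have h1 : φ a = a := φ.commutes ⟨a, ha⟩
      have h2 : φ (σ a) = σ a := φ.commutes ⟨σ a, hσa⟩
      rw [hτ, h1]
      conv_lhs => rw [← h2]
      exact φ.symm_apply_apply _
    obtain ⟨y, hy, hτy⟩ := ih τ fun τ₁ h₁ => hσ τ₁ fun a ha => (h₁ a ha).trans (hτL a ha)
    refine ⟨OnePoint.map φ y, ?_, ?_⟩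
    · rw [Function.iterate_succ_apply']
      have h1 : (ratMap f Ω)^[n] (OnePoint.map φ y) = OnePoint.map φ ((ratMap f Ω)^[n] y) :=
        iterate_ratMap_map f (φ' : Ω →ₐ[K] Ω) n y
      rw [h1, hy, OnePoint.map_some, hφ]
      exact hx
    · induction y using OnePoint.rec with
      | infty => rfl
      | coe y =>
        rw [OnePoint.map_some, OnePoint.coe_eq_coe, hτ, AlgEquiv.symm_apply_eq] at hτy
        rw [OnePoint.map_some, OnePoint.map_some, hτy]

/-- An automorphism sending `t` to `y` carries a preimage of `t` to a preimage of `y`. So a single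
preimage of `t` in `Ω` suffices, and `f` need not be assumed separable. -/
theorem parent_surjective_X (f : RatFunc K)
    (h1 : ∃ x, ratMap f Ω x = OnePoint.some (algebraMap (RatFunc K) Ω RatFunc.X)) (n : ℕ) :
    Function.Surjective (parent f (algebraMap (RatFunc K) Ω RatFunc.X) n) := by
  rintro ⟨y, hy⟩
  obtain ⟨x, hx⟩ := h1
  obtain ⟨y, rfl⟩ := exists_eq_coe_of_iterate_ratMap f hy
  obtain ⟨φ, hφ⟩ := exists_algEquiv_separableClosure f hy
  have h2 : ratMap f Ω (OnePoint.map φ x) = OnePoint.some y := by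
    have h3 : ratMap f Ω (OnePoint.map φ x) = OnePoint.map φ (ratMap f Ω x) :=
      ratMap_map f ((φ.restrictScalars K : Ω ≃ₐ[K] Ω) : Ω →ₐ[K] Ω) x
    rw [h3, hx, OnePoint.map_some, hφ]
  exact ⟨⟨OnePoint.map φ x, by rw [Function.iterate_succ_apply, h2, hy]⟩, Subtype.ext h2⟩

end SelfSimilarity

/-! ### Cosets of the geometric monodromy group. -/

section Monodromy

variable {K : Type*} [Field K] {f : RatFunc K} {Ω : Type*} [Field Ω] [Algebra K Ω]
  [Algebra (RatFunc K) Ω] [IsScalarTower K (RatFunc K) Ω]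

/-- The action of `σ` on the first level, as an element of the arithmetic monodromy group. -/
noncomputable def toMonodromy (f : RatFunc K) (σ : Ω ≃ₐ[RatFunc K] Ω) : arithmeticMonodromy f Ω :=
  ⟨levelAction f _ 1 (arborealRep Ω f RatFunc.X σ), levelAction_mem_levelGroup
    (G := arithmeticGroup Ω f RatFunc.X) (MonoidHom.mem_range.2 ⟨σ, rfl⟩) 1⟩

theorem mk_toMonodromy_eq {σ τ : Ω ≃ₐ[RatFunc K] Ω}
    (h : ∀ a ∈ separableClosure K Ω, τ a = σ a) :
    (toMonodromy f τ : MonodromyQuotient f Ω) = toMonodromy f σ := by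
  refine (QuotientGroup.eq (s := (geometricMonodromy f Ω).subgroupOf _)).2 ?_
  rw [Subgroup.mem_subgroupOf]
  refine ⟨arborealRep Ω f RatFunc.X (τ⁻¹ * σ), ⟨τ⁻¹ * σ, ?_, rfl⟩, ?_⟩
  -- By the Galois correspondence for the cyclic group generated by `τ⁻¹σ`, it suffices to check the
  -- generators of `F(Kˢᵉᵖ)`.
  · refine (IntermediateField.le_iff_le (Subgroup.zpowers (τ⁻¹ * σ)) _).1 ?_
      (Subgroup.mem_zpowers _)
    rw [IntermediateField.adjoin_le_iff]
    intro a ha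
    have h1 : (τ⁻¹ * σ) ∈ MulAction.stabilizer (Ω ≃ₐ[RatFunc K] Ω) a := by
      change τ⁻¹ (σ a) = a
      rw [← h a ha]
      exact τ.symm_apply_apply a
    rintro ⟨g, hg⟩
    exact (Subgroup.zpowers_le.2 h1) hg
  · simp only [map_mul, map_inv]
    rfl

theorem exists_fixed_of_mk_mem [IsSepClosure (RatFunc K) Ω] {M : Set (MonodromyQuotient f Ω)}
    (hM : IsBadMonodromySet f Ω M) {σ : Ω ≃ₐ[RatFunc K] Ω}
    (hσ : (toMonodromy f σ : MonodromyQuotient f Ω) ∈ M) (n : ℕ) :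
    ∃ v, levelAction f _ n (arborealRep Ω f RatFunc.X σ) v = v := by
  obtain ⟨x, hx, hσx⟩ := exists_fixed_of_forall_eqOn f σ (fun τ hτ => by
    rw [← mk_toMonodromy_eq hτ] at hσ
    obtain ⟨v, hv⟩ := hM.2 _ hσ
    exact ⟨v.1, v.2, congrArg Subtype.val hv⟩) n
  exact ⟨⟨x, hx⟩, Subtype.ext hσx⟩

theorem exists_ratMap_eq_X {M : Set (MonodromyQuotient f Ω)} (hM : IsBadMonodromySet f Ω M) :
    ∃ x, ratMap f Ω x = OnePoint.some (algebraMap (RatFunc K) Ω RatFunc.X) := by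
  obtain ⟨m, hm⟩ := hM.1
  obtain ⟨g, rfl⟩ := QuotientGroup.mk_surjective m
  obtain ⟨v, -⟩ := hM.2 g hm
  exact ⟨v.1, v.2⟩

end Monodromy

/-! ### Galois conjugacy of homomorphisms out of integral closures. -/

section Conjugacy

/-- A single `g` must serve all `s i`, so they are packed into one polynomial `b`. The product of `Y
- g • b` over `g ∈ G` has invariant coefficients, hence the same image under `φ` and `ψ`. Thus
`ψ(b)` is a root of the `φ`-image, and over a domain it equals some `φ(g • b)`; comparing
coefficients gives the claim. -/
theorem exists_smul_of_comp_algebraMap_eq {A C E G : Type*} [CommRing A] [CommRing C] [Algebra A C]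
    [Group G] [Finite G] [MulSemiringAction G C] [Algebra.IsInvariant A C G] [CommRing E]
    [IsDomain E] (φ ψ : C →+* E) (h : φ.comp (algebraMap A C) = ψ.comp (algebraMap A C)) (n : ℕ)
    (s : Fin n → C) : ∃ g : G, ∀ i, ψ (s i) = φ (g • s i) := by
  classical
  cases nonempty_fintype G
  let b : Polynomial C := Polynomial.ofFn n s
  have hb (i : Fin n) : b.coeff i = s i := Polynomial.ofFn_coeff_eq_val_of_lt s i.2
  let P := MulSemiringAction.charpoly G b
  have hP : P.map (Polynomial.mapRingHom φ) = P.map (Polynomial.mapRingHom ψ) := by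
    ext k j
    simp only [Polynomial.coeff_map, Polynomial.coe_mapRingHom]
    obtain ⟨a, ha⟩ := Algebra.IsInvariant.isInvariant (A := A) (G := G) ((P.coeff k).coeff j)
      (fun g => by
        rw [← Polynomial.coeff_smul, MulSemiringAction.smul_coeff_charpoly])
    rw [← ha]
    exact RingHom.congr_fun h a
  have hev : (P.map (Polynomial.mapRingHom ψ)).eval (b.map ψ) = 0 := by
    have h1 := Polynomial.eval_map_apply (Polynomial.mapRingHom ψ) (p := P) b
    rw [MulSemiringAction.eval_charpoly, map_zero] at h1
    exact h1
  rw [← hP] at hev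
  simp only [P, MulSemiringAction.charpoly_eq] at hev
  rw [Polynomial.map_prod, Polynomial.eval_prod,
    Finset.prod_eq_zero_iff] at hev
  obtain ⟨g, -, hg⟩ := hev
  rw [Polynomial.map_sub, Polynomial.map_X, Polynomial.map_C, Polynomial.eval_sub,
    Polynomial.eval_X, Polynomial.eval_C, sub_eq_zero] at hg
  refine ⟨g, fun i => ?_⟩
  have := congrArg (fun p => p.coeff (i : ℕ)) hg
  simpa [Polynomial.coeff_map, hb] using this

theorem exists_algEquiv_of_comp_algebraMap_eq {A F Ω E : Type*} [CommRing A] [IsDomain A]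
    [IsIntegrallyClosed A] [Field F] [Algebra A F] [IsFractionRing A F] [Field Ω] [Algebra F Ω]
    [Algebra A Ω] [IsScalarTower A F Ω] [IsGalois F Ω] [CommRing E] [IsDomain E]
    (φ ψ : integralClosure A Ω →+* E)
    (h : φ.comp (algebraMap A _) = ψ.comp (algebraMap A _)) {ι : Type*} [Finite ι]
    (s : ι → integralClosure A Ω) :
    ∃ τ : Ω ≃ₐ[F] Ω, ∀ i (s' : integralClosure A Ω), (s' : Ω) = τ (s i) → ψ (s i) = φ s' := by
  obtain ⟨n, ⟨e⟩⟩ := Finite.exists_equiv_fin ι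
  -- Finitely many elements lie in a finite Galois subextension; there the Galois group is finite,
  -- and the element found lifts to `Ω`.
  let N := FiniteGaloisIntermediateField.adjoin F (Set.range fun i => (s i : Ω))
  have hN (i : ι) : (s i : Ω) ∈ N.toIntermediateField :=
    FiniteGaloisIntermediateField.subset_adjoin F _ ⟨i, rfl⟩
  have : IsScalarTower A N.toIntermediateField Ω := IsScalarTower.of_algebraMap_eq fun a =>
    rfl
  have : IsFractionRing (integralClosure A N.toIntermediateField) N.toIntermediateField :=
    IsIntegralClosure.isFractionRing_of_finite_extension A F N.toIntermediateField _
  let j : integralClosure A N.toIntermediateField →ₐ[A] integralClosure A Ω :=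
    { toFun := fun x => ⟨x.1.1, x.2.map (IsScalarTower.toAlgHom A N.toIntermediateField Ω)⟩
      map_one' := rfl
      map_mul' := fun _ _ => rfl
      map_zero' := rfl
      map_add' := fun _ _ => rfl
      commutes' := fun _ => rfl }
  have hint (i : ι) : IsIntegral A (⟨s i, hN i⟩ : N.toIntermediateField) :=
    (isIntegral_algHom_iff (IsScalarTower.toAlgHom A N.toIntermediateField Ω)
      (algebraMap N.toIntermediateField Ω).injective).1 (s i).2
  let s₀ (i : ι) : integralClosure A N.toIntermediateField := ⟨⟨s i, hN i⟩, hint i⟩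
  let _ := IsIntegralClosure.MulSemiringAction A F N.toIntermediateField
    (integralClosure A N.toIntermediateField)
  have := Algebra.isInvariant_of_isGalois A F N.toIntermediateField
    (integralClosure A N.toIntermediateField)
  obtain ⟨g, hg⟩ := exists_smul_of_comp_algebraMap_eq (A := A)
    (G := N.toIntermediateField ≃ₐ[F] N.toIntermediateField)
    (φ.comp j.toRingHom) (ψ.comp j.toRingHom)
    (RingHom.ext fun a => RingHom.congr_fun h a) n (s₀ ∘ e.symm)
  obtain ⟨τ, hτ⟩ := AlgEquiv.restrictNormalHom_surjective (F := F) (K₁ := N.toIntermediateField)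
    (E := Ω) g
  refine ⟨τ, fun i s' hs' => ?_⟩
  have hgi := hg (e i)
  rw [Function.comp_apply, Equiv.symm_apply_apply] at hgi
  refine hgi.trans (congrArg φ (Subtype.ext ?_))
  rw [hs']
  have h1 : algebraMap _ N.toIntermediateField (g • s₀ i) =
      g (algebraMap _ N.toIntermediateField (s₀ i)) :=
    algebraMap_galRestrict_apply A g (s₀ i)
  have h2 := AlgEquiv.restrictNormal_commutes τ N.toIntermediateField ⟨s i, hN i⟩
  have h3 : τ.restrictNormal N.toIntermediateField = g := hτ
  rw [h3] at h2
  exact (congrArg Subtype.val h1).trans h2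

end Conjugacy

/-! ### Integral homogeneous coordinates with nonzero reduction. -/

section Coordinates

/-- With `a` the leading coefficient of `F`, the element `c = a y` is integral, so `[c : a]`
represents `y`. It works unless `c` and `a` both reduce to zero. -/
theorem exists_integral_coordinates {B Ω E : Type*} [CommRing B] [Field Ω] [Algebra B Ω]
    [IsIntegrallyClosedIn B Ω] [CommRing E] (φ : B →+* E) (y : Ω) (F : Polynomial B)
    (hy : Polynomial.aeval y F = 0) (hF : F.map φ ≠ 0) :
    ∃ u v : B, (φ u ≠ 0 ∨ φ v ≠ 0) ∧ algebraMap B Ω u = algebraMap B Ω v * y := by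
  obtain ⟨n, hn⟩ : ∃ n, F.natDegree ≤ n := ⟨_, le_rfl⟩
  have hinj : Function.Injective (algebraMap B Ω) :=
    IsIntegralClosure.algebraMap_injective B B Ω
  induction n generalizing F with
  | zero =>
    rw [Polynomial.eq_C_of_natDegree_le_zero hn, Polynomial.aeval_C, map_eq_zero_iff _ hinj] at hy
    rw [Polynomial.eq_C_of_natDegree_le_zero hn, hy] at hF
    simp at hF
  | succ n ih =>
    by_cases h0 : F.natDegree ≤ n
    · exact ih F hy hF h0
    have hd : F.natDegree = n + 1 := by omega
    obtain ⟨c, hc⟩ := IsIntegrallyClosedIn.isIntegral_iff.1 (isIntegral_leadingCoeff_smul F y hy)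
    rw [Algebra.smul_def] at hc
    by_cases ha : φ F.leadingCoeff = 0
    · by_cases hc0 : φ c = 0
      -- Rewriting `a yⁿ⁺¹` as `c yⁿ` lowers the degree bound and keeps the root; the reduction is
      -- unchanged because `a` and `c` both reduce to zero.
      · refine ih (F.eraseLead + Polynomial.C c * Polynomial.X ^ n) ?_ ?_ ?_
        · have h1 := F.eraseLead_add_C_mul_X_pow
          have h2 := congrArg (Polynomial.aeval y) h1
          rw [hy, hd] at h2
          rw [← h2]
          simp only [map_add, map_mul, Polynomial.aeval_C, map_pow, Polynomial.aeval_X, hc]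
          ring
        · have h1 := congrArg (Polynomial.map φ) F.eraseLead_add_C_mul_X_pow
          simp only [Polynomial.map_add, Polynomial.map_mul, Polynomial.map_C, ha, map_zero,
            zero_mul, add_zero] at h1
          simpa [hc0, h1] using hF
        · refine Polynomial.natDegree_add_le_of_degree_le ?_ (Polynomial.natDegree_C_mul_X_pow_le _ _)
          have := F.eraseLead_natDegree_le
          omega
      · exact ⟨c, F.leadingCoeff, Or.inl hc0, hc⟩
    · exact ⟨c, F.leadingCoeff, Or.inr ha, hc⟩

theorem algebraMap_polynomial_injective (K Ω : Type*) [Field K] [Field Ω] [Algebra (RatFunc K) Ω]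
    [Algebra (Polynomial K) Ω] [IsScalarTower (Polynomial K) (RatFunc K) Ω] :
    Function.Injective (algebraMap (Polynomial K) Ω) := by
  rw [IsScalarTower.algebraMap_eq (Polynomial K) (RatFunc K) Ω]
  exact (algebraMap (RatFunc K) Ω).injective.comp (IsFractionRing.injective _ _)

/-- The primitive part of an annihilating polynomial is not divisible by the nonunit `X - α`. -/
theorem exists_annihilator_map_eval_ne_zero {K Ω : Type*} [Field K] [Field Ω]
    [Algebra (Polynomial K) Ω] [Module.IsTorsionFree (Polynomial K) Ω] (α : K) {y : Ω}
    (hy : IsAlgebraic (Polynomial K) y) :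
    ∃ F : Polynomial (Polynomial K), Polynomial.aeval y F = 0 ∧
      F.map (Polynomial.evalRingHom α) ≠ 0 := by
  classical
  obtain ⟨p, hp, hpy⟩ := hy
  refine ⟨p.primPart, Polynomial.aeval_primPart_eq_zero hp hpy, fun h => ?_⟩
  have h1 : Polynomial.C (Polynomial.X - Polynomial.C α) ∣ p.primPart := by
    rw [Polynomial.C_dvd_iff_dvd_coeff]
    intro i
    rw [Polynomial.dvd_iff_isRoot]
    have := congrArg (fun q => q.coeff i) h
    simpa using this
  exact Polynomial.not_isUnit_X_sub_C α (p.isPrimitive_primPart _ h1)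

end Coordinates

/-! ### Reduction at a place and lifting of Galois automorphisms. -/

section Place

variable {K : Type*} [Field K] {Ω E : Type*} [Field Ω] [Field E] [Algebra K E]
  {V : ValuationSubring Ω} [Algebra K V] (φ : V →ₐ[K] E)

open Classical in
/-- The reduction map `ℙ¹(Ω) → ℙ¹(E)` attached to a place of `Ω` with valuation ring `V`. -/
noncomputable def reduction : OnePoint Ω → OnePoint E
  | OnePoint.infty => OnePoint.infty
  | OnePoint.some y => if h : y ∈ V then OnePoint.some (φ ⟨y, h⟩) else OnePoint.infty

theorem exists_projPoint_valuationSubring (x : OnePoint Ω) :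
    ∃ u v : V, (φ u ≠ 0 ∨ φ v ≠ 0) ∧ x = projPoint (u : Ω) v := by
  induction x using OnePoint.rec with
  | infty => exact ⟨1, 0, Or.inl (by simp), by simp [projPoint]⟩
  | coe a =>
    rcases V.mem_or_inv_mem a with h | h
    · exact ⟨⟨a, h⟩, 1, Or.inr (by simp), by simp [projPoint]⟩
    · by_cases ha : a = 0
      · exact ⟨0, 1, Or.inr (by simp), by simp [projPoint, ha]⟩
      · exact ⟨1, ⟨a⁻¹, h⟩, Or.inl (by simp), by simp [projPoint, ha]⟩

variable [IsLocalHom φ]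

theorem reduction_projPoint (u v : V) (h : φ u ≠ 0 ∨ φ v ≠ 0) :
    reduction φ (projPoint (u : Ω) v) = projPoint (φ u) (φ v) := by
  by_cases hv : φ v = 0
  · have hu : φ u ≠ 0 := by simpa [hv] using h
    rw [projPoint, projPoint, if_pos hv]
    split_ifs with hv0
    · rfl
    · have hmem : (u : Ω) / v ∉ V := by
        intro hmem
        have h1 : u = ⟨(u : Ω) / v, hmem⟩ * v := Subtype.ext (div_mul_cancel₀ _ hv0).symm
        apply hu
        rw [h1, map_mul, hv, mul_zero]
      exact dif_neg hmem
  · obtain ⟨w, hw⟩ := isUnit_of_map_unit φ v (isUnit_iff_ne_zero.2 hv)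
    have hv0 : (v : Ω) ≠ 0 := by
      intro h0
      have : v = 0 := Subtype.ext h0
      exact hv (by rw [this, map_zero])
    have h1 : (u : Ω) / v = (u * (w⁻¹ : Vˣ) : V) := by
      rw [div_eq_iff hv0, ← hw]
      exact congrArg Subtype.val (Units.inv_mul_cancel_right u w).symm
    rw [projPoint, projPoint, if_neg hv, if_neg hv0]
    have hmem : (u : Ω) / v ∈ V := h1 ▸ (u * (w⁻¹ : Vˣ) : V).2
    refine (dif_pos hmem).trans (congrArg OnePoint.some ?_)
    rw [eq_div_iff hv, ← map_mul]
    exact congrArg φ (Subtype.ext (div_mul_cancel₀ _ hv0))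

variable [Algebra K Ω] [IsScalarTower K V Ω]

theorem reduction_ratMap (f : RatFunc K) (x : OnePoint Ω) :
    reduction φ (ratMap f Ω x) = ratMap f E (reduction φ x) := by
  obtain ⟨u, v, h, rfl⟩ := exists_projPoint_valuationSubring φ x
  have h' : (u : Ω) ≠ 0 ∨ (v : Ω) ≠ 0 := by
    refine h.imp ?_ ?_ <;>
    · intro h1 h0
      exact h1 (by rw [Subtype.ext (a2 := (0 : V)) h0, map_zero])
  have hc (p : Polynomial K) (d : ℕ) : homEval p d (u : Ω) v = (homEval p d u v : V) :=
    (map_homEval p d (IsScalarTower.toAlgHom K V Ω) u v).symm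
  rw [ratMap_projPoint f h', hc, hc, reduction_projPoint, reduction_projPoint φ u v h,
    map_homEval, map_homEval, ratMap_projPoint f h]
  rw [map_homEval, map_homEval]
  exact homEval_num_or_denom_ne_zero f h

theorem reduction_iterate_ratMap (f : RatFunc K) (n : ℕ) (x : OnePoint Ω) :
    reduction φ ((ratMap f Ω)^[n] x) = (ratMap f E)^[n] (reduction φ x) :=
  Function.Semiconj.iterate_right (reduction_ratMap φ f) n x

/-- `V` need not be stable under `τ`, but the integral closure of `K[t]` is, and it lies in `V`. So
the points are given coordinates in this integral closure. On it, `φ` and `σ ∘ φ` agree over `K[t]`,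
since both evaluate at `α ∈ K`; hence they are conjugate on finitely many coordinates. -/
theorem exists_algEquiv_reduction_eq [Algebra (RatFunc K) Ω] [IsScalarTower K (RatFunc K) Ω]
    [IsGalois (RatFunc K) Ω] [Algebra (Polynomial K) Ω]
    [IsScalarTower (Polynomial K) (RatFunc K) Ω] (α : K)
    (ht : algebraMap (Polynomial K) Ω Polynomial.X ∈ V)
    (hα : φ ⟨_, ht⟩ = algebraMap K E α) (σ : E ≃ₐ[K] E) {ι : Type*} [Finite ι]
    (y : ι → OnePoint Ω) :
    ∃ τ : Ω ≃ₐ[RatFunc K] Ω, ∀ i,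
      reduction φ (OnePoint.map τ (y i)) = OnePoint.map σ (reduction φ (y i)) := by
  have : IsScalarTower K (Polynomial K) Ω := IsScalarTower.of_algebraMap_eq fun k => by
    rw [IsScalarTower.algebraMap_apply (Polynomial K) (RatFunc K) Ω,
      ← IsScalarTower.algebraMap_apply K (Polynomial K) (RatFunc K),
      ← IsScalarTower.algebraMap_apply]
  have hA (p : Polynomial K) :
      algebraMap (Polynomial K) Ω p = (Polynomial.aeval (⟨_, ht⟩ : V) p : V) := by
    have h1 := Polynomial.aeval_algebraMap_apply Ω (⟨_, ht⟩ : V) p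
    change Polynomial.aeval (algebraMap (Polynomial K) Ω Polynomial.X) p = _ at h1
    rw [Polynomial.aeval_algebraMap_apply, Polynomial.aeval_X_left_apply] at h1
    exact h1
  -- A valuation ring is integrally closed, and `V` contains `K[t]`.
  have hB (b : integralClosure (Polynomial K) Ω) : (b : Ω) ∈ V := by
    let _ : Algebra (Polynomial K) V := (Polynomial.aeval (⟨_, ht⟩ : V)).toRingHom.toAlgebra
    have : IsScalarTower (Polynomial K) V Ω := IsScalarTower.of_algebraMap_eq hA
    obtain ⟨c, hc⟩ := IsIntegrallyClosed.isIntegral_iff.1 (b.2.tower_top (A := V))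
    exact hc ▸ c.2
  let j : integralClosure (Polynomial K) Ω →+* V :=
    (algebraMap (integralClosure (Polynomial K) Ω) Ω).codRestrict V.toSubring hB
  let φ' : integralClosure (Polynomial K) Ω →+* E := (φ : V →+* E).comp j
  have hφ' (p : Polynomial K) : φ' (algebraMap _ _ p) = algebraMap K E (p.eval α) := by
    have h1 : j (algebraMap _ _ p) = Polynomial.aeval (⟨_, ht⟩ : V) p := Subtype.ext (hA p)
    change φ (j _) = _
    rw [h1, ← Polynomial.aeval_algHom_apply, hα, Polynomial.aeval_algebraMap_apply,
      Polynomial.coe_aeval_eq_eval]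
  have hcoord (x : OnePoint Ω) : ∃ u v : integralClosure (Polynomial K) Ω,
      (φ' u ≠ 0 ∨ φ' v ≠ 0) ∧ x = projPoint (u : Ω) v := by
    induction x using OnePoint.rec with
    | infty => exact ⟨1, 0, Or.inl (by simp), by simp [projPoint]⟩
    | coe a =>
      have : FaithfulSMul (Polynomial K) Ω := (faithfulSMul_iff_algebraMap_injective _ _).2
        (algebraMap_polynomial_injective K Ω)
      have halg : IsAlgebraic (Polynomial K) a :=
        (IsFractionRing.isAlgebraic_iff (Polynomial K) (RatFunc K) Ω).2
          (Algebra.IsAlgebraic.isAlgebraic a)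
      obtain ⟨F, hF0, hF⟩ := exists_annihilator_map_eval_ne_zero α halg
      obtain ⟨u, v, huv, h⟩ := exists_integral_coordinates φ' a
        (F.map (algebraMap (Polynomial K) (integralClosure (Polynomial K) Ω)))
        (by rwa [Polynomial.aeval_map_algebraMap]) (by
          have h1 : φ'.comp (algebraMap (Polynomial K) (integralClosure (Polynomial K) Ω)) =
              (algebraMap K E).comp (Polynomial.evalRingHom α) := RingHom.ext hφ'
          rw [Polynomial.map_map, h1, ← Polynomial.map_map]
          exact (Polynomial.map_ne_zero_iff (algebraMap K E).injective).2 hF)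
      refine ⟨u, v, huv, ?_⟩
      change (u : Ω) = v * a at h
      have hv : (v : Ω) ≠ 0 := by
        intro h0
        rw [h0, zero_mul] at h
        have hu' : u = 0 := Subtype.ext h
        have hv' : v = 0 := Subtype.ext h0
        simp [hu', hv'] at huv
      rw [projPoint, if_neg hv, h, mul_div_cancel_left₀ _ hv]
  choose u v huv hy using fun i => hcoord (y i)
  obtain ⟨τ, hτ⟩ := exists_algEquiv_of_comp_algebraMap_eq (F := RatFunc K) φ'
    ((σ : E →+* E).comp φ') (RingHom.ext fun p => by
      change φ' _ = σ (φ' _)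
      rw [hφ', σ.commutes]) (Sum.elim u v)
  have hint (b : integralClosure (Polynomial K) Ω) :
      τ b ∈ integralClosure (Polynomial K) Ω :=
    b.2.map (τ.restrictScalars (Polynomial K))
  refine ⟨τ, fun i => ?_⟩
  have hu : σ (φ' (u i)) = φ' ⟨τ (u i), hint _⟩ := hτ (Sum.inl i) _ rfl
  have hv : σ (φ' (v i)) = φ' ⟨τ (v i), hint _⟩ := hτ (Sum.inr i) _ rfl
  have h1 : OnePoint.map τ (projPoint (u i : Ω) (v i)) = projPoint (τ (u i)) (τ (v i)) :=
    map_projPoint (τ : Ω →+* Ω) _ _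
  have h2 : OnePoint.map σ (projPoint (φ' (u i)) (φ' (v i))) =
      projPoint (σ (φ' (u i))) (σ (φ' (v i))) := map_projPoint (σ : E →+* E) _ _
  rw [hy i, h1]
  have h3 : reduction φ (projPoint (u i : Ω) (v i)) = projPoint (φ' (u i)) (φ' (v i)) :=
    reduction_projPoint φ (j (u i)) (j (v i)) (huv i)
  rw [h3, h2, hu, hv]
  refine reduction_projPoint φ (j ⟨τ (u i), hint _⟩) (j ⟨τ (v i), hint _⟩) ?_
  change φ' _ ≠ 0 ∨ φ' _ ≠ 0
  rw [← hu, ← hv]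
  simpa using huv i

end Place

/-! ### Existence of a place above `t = α`. -/

section PlaceExistence

variable {K : Type*} [Field K] {Ω : Type*} [Field Ω] [Algebra K Ω] [Algebra (RatFunc K) Ω]
  [IsScalarTower K (RatFunc K) Ω] [Algebra.IsAlgebraic (RatFunc K) Ω] [Algebra (Polynomial K) Ω]
  [IsScalarTower (Polynomial K) (RatFunc K) Ω]

variable (Ω) in
-- Some valuation ring of `Ω` contains `K[t]` and has `t - α` as a nonunit. Its residue field is
-- algebraic over `K`, hence embeds in the algebraic closure.
theorem exists_place (α : K) :
    ∃ (V : ValuationSubring Ω) (_ : Algebra K V) (_ : IsScalarTower K V Ω)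
      (φ : V →ₐ[K] AlgebraicClosure K) (_ : IsLocalHom φ)
      (ht : algebraMap (Polynomial K) Ω Polynomial.X ∈ V),
      φ ⟨_, ht⟩ = algebraMap K (AlgebraicClosure K) α := by
  have hinj := algebraMap_polynomial_injective K Ω
  have hK (k : K) : algebraMap K Ω k = algebraMap (Polynomial K) Ω (Polynomial.C k) := by
    rw [IsScalarTower.algebraMap_apply (Polynomial K) (RatFunc K) Ω,
      IsScalarTower.algebraMap_apply K (RatFunc K) Ω]
    rfl
  let e : Polynomial K ≃+* (algebraMap (Polynomial K) Ω).range :=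
    RingEquiv.ofBijective (algebraMap (Polynomial K) Ω).rangeRestrict
      ⟨fun a b h => hinj (congrArg Subtype.val h), RingHom.rangeRestrict_surjective _⟩
  obtain ⟨V, hV, hI⟩ := Ideal.image_subset_nonunits_valuationSubring
    (Ideal.span {e (Polynomial.X - Polynomial.C α)}) (by
      rw [Ne, Ideal.span_singleton_eq_top, MulEquiv.isUnit_map]
      exact Polynomial.not_isUnit_X_sub_C α)
  have hmem (p : Polynomial K) : algebraMap (Polynomial K) Ω p ∈ V := hV ⟨p, rfl⟩
  let i : Polynomial K →+* V := (algebraMap (Polynomial K) Ω).codRestrict V.toSubring hmem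
  let _ : Algebra K V := (i.comp Polynomial.C).toAlgebra
  have hVΩ : IsScalarTower K V Ω := IsScalarTower.of_algebraMap_eq hK
  let k := IsLocalRing.ResidueField V
  have hres (p : Polynomial K) : IsLocalRing.residue V (i p) = algebraMap K k (p.eval α) := by
    have h1 : (IsLocalRing.residue V).comp i =
        (algebraMap K k).comp (Polynomial.evalRingHom α) := by
      refine Polynomial.ringHom_ext (fun a => ?_) ?_
      · simp only [RingHom.comp_apply, Polynomial.coe_evalRingHom, Polynomial.eval_C]
        rfl
      · have h2 : (e (Polynomial.X - Polynomial.C α) : Ω) ∈ V.nonunits :=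
          hI ⟨_, Ideal.mem_span_singleton_self _, rfl⟩
        have h3 : i (Polynomial.X - Polynomial.C α) ∈ IsLocalRing.maximalIdeal V :=
          ValuationSubring.coe_mem_nonunits_iff.1 h2
        have h4 := (IsLocalRing.residue_eq_zero_iff _).2 h3
        rw [map_sub, map_sub, sub_eq_zero] at h4
        simp only [RingHom.comp_apply, Polynomial.coe_evalRingHom, Polynomial.eval_X]
        exact h4
    exact RingHom.congr_fun h1 p
  have halg : Algebra.IsAlgebraic K k := by
    refine ⟨fun r => ?_⟩
    obtain ⟨v, rfl⟩ := IsLocalRing.residue_surjective r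
    have : FaithfulSMul (Polynomial K) Ω := (faithfulSMul_iff_algebraMap_injective _ _).2 hinj
    have hv : IsAlgebraic (Polynomial K) (v : Ω) :=
      (IsFractionRing.isAlgebraic_iff (Polynomial K) (RatFunc K) Ω).2
        (Algebra.IsAlgebraic.isAlgebraic _)
    obtain ⟨F, hF0, hF⟩ := exists_annihilator_map_eval_ne_zero α hv
    -- Evaluating the coefficients of `F` at `α` gives a nonzero polynomial over `K` that kills the
    -- residue of `v`.
    refine ⟨_, hF, ?_⟩
    have h1 : F.eval₂ i v = 0 := by
      apply Subtype.ext
      have h2 := Polynomial.hom_eval₂ F i (algebraMap V Ω) v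
      exact h2.trans hF0
    have h3 := Polynomial.hom_eval₂ F i (IsLocalRing.residue V) v
    rw [h1, map_zero] at h3
    rw [Polynomial.aeval_def, Polynomial.eval₂_map, h3]
    congr 1
    exact RingHom.ext fun p => (hres p).symm
  let φ : V →ₐ[K] AlgebraicClosure K :=
    (IsAlgClosed.lift : k →ₐ[K] AlgebraicClosure K).comp (IsScalarTower.toAlgHom K V k)
  refine ⟨V, inferInstance, hVΩ, φ, ⟨fun a ha => ?_⟩, hmem _, ?_⟩
  · have h1 : IsLocalRing.residue V a ≠ 0 := by
      intro h0
      have : φ a = 0 := by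
        change (IsAlgClosed.lift : k →ₐ[K] AlgebraicClosure K) (IsLocalRing.residue V a) = 0
        rw [h0, map_zero]
      exact ha.ne_zero this
    exact (IsLocalRing.residue_ne_zero_iff_isUnit a).1 h1
  · change (IsAlgClosed.lift : k →ₐ[K] AlgebraicClosure K)
      (IsLocalRing.residue V (i Polynomial.X)) = _
    rw [hres, Polynomial.eval_X, AlgHom.commutes]

end PlaceExistence

/-! ### Colliding preimages reduce to a ramification point. -/

section Ramification

theorem sq_dvd_map_of_eval_eq_zero {R S : Type*} [CommRing R] [IsDomain R] [CommRing S]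
    (φ : R →+* S) {P : Polynomial R} {a b : R} (hab : a ≠ b) (ha : P.eval a = 0)
    (hb : P.eval b = 0) (h : φ a = φ b) :
    (Polynomial.X - Polynomial.C (φ a)) ^ 2 ∣ P.map φ := by
  obtain ⟨Q, rfl⟩ := Polynomial.dvd_iff_isRoot.2 ha
  rw [Polynomial.eval_mul, Polynomial.eval_sub, Polynomial.eval_X, Polynomial.eval_C,
    mul_eq_zero, sub_eq_zero, or_iff_right hab.symm] at hb
  obtain ⟨Q', rfl⟩ := Polynomial.dvd_iff_isRoot.2 hb
  refine ⟨Q'.map φ, ?_⟩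
  simp only [Polynomial.map_mul, Polynomial.map_sub, Polynomial.map_X, Polynomial.map_C, ← h]
  ring

variable {K : Type*} [Field K] {Ω E : Type*} [Field Ω] [Field E] [Algebra K Ω] [Algebra K E]
  {V : ValuationSubring Ω} [Algebra K V] [IsScalarTower K V Ω] (φ : V →ₐ[K] E) [IsLocalHom φ]
  {f : RatFunc K}

/-- Two distinct roots of `p - β q` with the same reduction give a double root of the reduced form.
If the common reduction is `∞`, the argument runs with the reversed polynomial and the roots `a⁻¹`,
`b⁻¹`, which reduce to zero. -/
theorem two_le_ramificationIndex_reduction (hf : 2 ≤ ratDegree f) (β : V) {a b : Ω} (hab : a ≠ b)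
    (ha : ratMap f Ω (OnePoint.some a) = OnePoint.some (β : Ω))
    (hb : ratMap f Ω (OnePoint.some b) = OnePoint.some (β : Ω))
    (h : reduction φ (OnePoint.some a) = reduction φ (OnePoint.some b)) :
    2 ≤ ramificationIndex f E (reduction φ (OnePoint.some a)) := by
  let P : Polynomial V :=
    f.num.map (algebraMap K V) - Polynomial.C β * f.denom.map (algebraMap K V)
  have hPΩ : P.map (algebraMap V Ω) = fiberPoly f Ω (OnePoint.some (β : Ω)) := by
    simp only [P, fiberPoly, Polynomial.map_sub, Polynomial.map_mul, Polynomial.map_map,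
      Polynomial.map_C, ← IsScalarTower.algebraMap_eq]
    rfl
  have hPE : P.map (φ : V →+* E) = fiberPoly f E (OnePoint.some (φ β)) := by
    simp only [P, fiberPoly, Polynomial.map_sub, Polynomial.map_mul, Polynomial.map_map,
      Polynomial.map_C, AlgHom.comp_algebraMap]
    rfl
  have hβ : reduction φ (OnePoint.some (β : Ω)) = OnePoint.some (φ β) := dif_pos β.2
  have hra : ratMap f E (reduction φ (OnePoint.some a)) = OnePoint.some (φ β) := by
    rw [← reduction_ratMap, ha, hβ]
  have hinj : Function.Injective (algebraMap V Ω) := Subtype.val_injective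
  rw [ratMap_coe_eq_iff, ← hPΩ] at ha hb
  have hne := fiberPoly_ne_zero (A := E) hf (OnePoint.some (φ β))
  by_cases haV : a ∈ V
  · have h1 : reduction φ (OnePoint.some a) = OnePoint.some (φ ⟨a, haV⟩) := dif_pos haV
    have hbV : b ∈ V := by
      by_contra hbV
      have h2 : reduction φ (OnePoint.some b) = OnePoint.infty := dif_neg hbV
      rw [h1, h2] at h
      exact OnePoint.coe_ne_infty _ h
    have h2 : reduction φ (OnePoint.some b) = OnePoint.some (φ ⟨b, hbV⟩) := dif_pos hbV
    rw [h1, h2, OnePoint.coe_eq_coe] at h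
    rw [h1] at hra ⊢
    simp only [ramificationIndex]
    rw [hra, Polynomial.le_rootMultiplicity_iff hne, ← hPE]
    have hev (c : V) (hc : (P.map (algebraMap V Ω)).eval (c : Ω) = 0) : P.eval c = 0 := by
      apply hinj
      rw [map_zero, ← Polynomial.eval_map_apply]
      exact hc
    exact sq_dvd_map_of_eval_eq_zero (φ : V →+* E) (fun h => hab (congrArg Subtype.val h))
      (hev ⟨a, haV⟩ ha) (hev ⟨b, hbV⟩ hb) h
  · have h1 : reduction φ (OnePoint.some a) = OnePoint.infty := dif_neg haV
    have hbV : b ∉ V := by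
      intro hbV
      have h2 : reduction φ (OnePoint.some b) = OnePoint.some (φ ⟨b, hbV⟩) := dif_pos hbV
      rw [h1, h2] at h
      exact OnePoint.infty_ne_coe _ h
    rw [h1] at hra ⊢
    simp only [ramificationIndex]
    rw [hra]
    have hinv (c : Ω) (hc : c ∉ V) : ∃ w : V, (w : Ω) = c⁻¹ ∧ φ w = 0 := by
      refine ⟨⟨c⁻¹, (V.mem_or_inv_mem c).resolve_left hc⟩, rfl, ?_⟩
      by_contra h0
      obtain ⟨w, hw⟩ := isUnit_of_map_unit φ _ (isUnit_iff_ne_zero.2 h0)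
      have hc0 : c ≠ 0 := fun h => hc (h ▸ V.zero_mem)
      have h5 : (w : V) * ((w⁻¹ : Vˣ) : V) = 1 := w.mul_inv
      rw [hw] at h5
      have h6 : c⁻¹ * (((w⁻¹ : Vˣ) : V) : Ω) = 1 := congrArg Subtype.val h5
      rw [inv_mul_eq_one₀ hc0] at h6
      exact hc (h6 ▸ ((w⁻¹ : Vˣ) : V).2)
    have hPd : P.natDegree ≤ ratDegree f := by
      rw [← Polynomial.natDegree_map_eq_of_injective hinj, hPΩ]
      exact natDegree_fiberPoly_le f _
    have hev (c : Ω) (hc : c ∉ V) (w : V) (hw : (w : Ω) = c⁻¹)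
        (h0 : (P.map (algebraMap V Ω)).eval c = 0) :
        (P.reflect (ratDegree f)).eval w = 0 := by
      have hc0 : c ≠ 0 := fun h => hc (h ▸ V.zero_mem)
      let _ := invertibleOfNonzero hc0
      have h5 := Polynomial.eval₂_reflect_mul_pow (algebraMap V Ω) c (ratDegree f) P hPd
      rw [← Polynomial.eval_map (x := c), h0, mul_eq_zero, or_iff_left (pow_ne_zero _ hc0),
        invOf_eq_inv, ← hw] at h5
      apply hinj
      rw [map_zero, ← h5]
      exact (Polynomial.eval₂_at_apply (algebraMap V Ω) w).symm
    obtain ⟨u, hu, hu0⟩ := hinv a haV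
    obtain ⟨w, hw, hw0⟩ := hinv b hbV
    have hdvd := sq_dvd_map_of_eval_eq_zero (φ : V →+* E)
      (P := P.reflect (ratDegree f)) (a := u) (b := w)
      (fun h => hab (inv_injective (by rw [← hu, ← hw, h])))
      (hev a haV u hu ha) (hev b hbV w hw hb) (hu0.trans hw0.symm)
    have hu0' : (φ : V →+* E) u = 0 := hu0
    rw [hu0', map_zero, sub_zero, ← Polynomial.reflect_map, hPE, Polynomial.X_pow_dvd_iff] at hdvd
    -- Divisibility of the reversed polynomial by `X²` kills the coefficients of index `d` and `d -
    -- 1`, where `d` is the degree of `f`.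
    have hdeg : (fiberPoly f E (OnePoint.some (φ β))).natDegree ≤ ratDegree f - 2 := by
      rw [Polynomial.natDegree_le_iff_coeff_eq_zero]
      intro N hN
      by_cases hN' : ratDegree f < N
      · exact Polynomial.coeff_eq_zero_of_natDegree_lt
          ((natDegree_fiberPoly_le f _).trans_lt hN')
      · have h7 := hdvd (ratDegree f - N) (by omega)
        rw [Polynomial.coeff_reflect, Polynomial.revAt_le (by omega)] at h7
        rwa [show ratDegree f - (ratDegree f - N) = N by omega] at h7
    omega

end Ramification

/-! ### Preimages of a point that is not post-critical are separable. -/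

section Separability

/-- An inseparable minimal polynomial has zero derivative, so all its roots are multiple, and it
divides `g`. -/
theorem isSeparable_of_rootMultiplicity_lt {L E : Type*} [Field L] [Field E] [Algebra L E]
    {g : Polynomial L} (hg : g ≠ 0) {a : E} (ha : Polynomial.aeval a g = 0)
    (hm : (g.map (algebraMap L E)).rootMultiplicity a < 2) : IsSeparable L a := by
  have hint : IsIntegral L a := IsAlgebraic.isIntegral ⟨g, hg, ha⟩
  have hirr := minpoly.irreducible hint
  rw [IsSeparable, Polynomial.separable_iff_derivative_ne_zero hirr]
  intro hd
  have hg' : g.map (algebraMap L E) ≠ 0 :=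
    (Polynomial.map_ne_zero_iff (algebraMap L E).injective).2 hg
  have hm' : (minpoly L a).map (algebraMap L E) ≠ 0 :=
    (Polynomial.map_ne_zero_iff (algebraMap L E).injective).2 hirr.ne_zero
  have h1 : ((minpoly L a).map (algebraMap L E)).IsRoot a := by
    rw [Polynomial.IsRoot.def, Polynomial.eval_map_algebraMap, minpoly.aeval]
  have h2 : 1 < ((minpoly L a).map (algebraMap L E)).rootMultiplicity a := by
    rw [Polynomial.one_lt_rootMultiplicity_iff_isRoot hm']
    refine ⟨h1, ?_⟩
    rw [Polynomial.derivative_map, hd, Polynomial.map_zero]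
    exact Polynomial.eval_zero
  have h3 := Polynomial.rootMultiplicity_le_rootMultiplicity_of_dvd hg'
    (Polynomial.map_dvd (algebraMap L E) (minpoly.dvd L a ha)) a
  omega

variable {K : Type*} [Field K] {f : RatFunc K} {L : Type*} [Field L] [Algebra K L] [IsSepClosed L]
  [Algebra L (AlgebraicClosure K)] [IsScalarTower K L (AlgebraicClosure K)]

theorem exists_map_eq_of_iterate_ratMap (hf : 2 ≤ ratDegree f) {α : K}
    (hα : ¬ IsStrictlyPostCritical f α) (n : ℕ) (x : OnePoint (AlgebraicClosure K))
    (hx : (ratMap f (AlgebraicClosure K))^[n] x =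
      OnePoint.some (algebraMap K (AlgebraicClosure K) α)) :
    ∃ y : OnePoint L, OnePoint.map (algebraMap L (AlgebraicClosure K)) y = x := by
  induction n generalizing x with
  | zero =>
    refine ⟨OnePoint.some (algebraMap K L α), ?_⟩
    rw [OnePoint.map_some, ← IsScalarTower.algebraMap_apply]
    exact hx.symm
  | succ n ih =>
    obtain ⟨b, hb⟩ := ih _ hx
    have hram : ramificationIndex f (AlgebraicClosure K) x < 2 := by
      by_contra! h
      exact hα ⟨n + 1, Nat.succ_pos n, x, h, hx⟩
    induction x using OnePoint.rec with
    | infty => exact ⟨OnePoint.infty, rfl⟩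
    | coe a =>
      have hmap : (fiberPoly f L b).map (algebraMap L (AlgebraicClosure K)) =
          fiberPoly f (AlgebraicClosure K)
            (OnePoint.map (algebraMap L (AlgebraicClosure K)) b) := by
        induction b using OnePoint.rec with
        | infty =>
          simp only [OnePoint.map_infty, fiberPoly, Polynomial.map_map,
            ← IsScalarTower.algebraMap_eq]
        | coe b =>
          simp only [OnePoint.map_some, fiberPoly, Polynomial.map_sub, Polynomial.map_mul,
            Polynomial.map_C, Polynomial.map_map, ← IsScalarTower.algebraMap_eq]
      have hroot := (ratMap_coe_eq_iff f a _).1 hb.symm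
      rw [← hmap, Polynomial.eval_map_algebraMap] at hroot
      simp only [ramificationIndex] at hram
      rw [← hb, ← hmap] at hram
      have hsep := isSeparable_of_rootMultiplicity_lt (fiberPoly_ne_zero hf b) hroot hram
      obtain ⟨c, hc⟩ := minpoly.mem_range_of_degree_eq_one L a
        (IsSepClosed.degree_eq_one_of_irreducible L (minpoly.irreducible hsep.isIntegral) hsep)
      exact ⟨OnePoint.some c, by rw [OnePoint.map_some, hc]⟩

end Separability

/-! ### From the tree of `t` to the tree of `α`. -/

section Specialization

variable {K : Type*} [Field K] {f : RatFunc K} {Ω : Type*} [Field Ω] [Algebra K Ω]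
  [Algebra (RatFunc K) Ω] [IsScalarTower K (RatFunc K) Ω] [IsSepClosure (RatFunc K) Ω]
  {L : Type*} [Field L] [Algebra K L] [IsSepClosure K L]

theorem parent_surjective_of_not_isStrictlyPostCritical (hf : 2 ≤ ratDegree f) {α : K}
    (hα : ¬ IsStrictlyPostCritical f α) (n : ℕ) :
    Function.Surjective (parent f (algebraMap K L α) n) := by
  have : IsSepClosed L := IsSepClosure.sep_closed K
  let i : L →ₐ[K] AlgebraicClosure K := IsAlgClosed.lift
  let _ : Algebra L (AlgebraicClosure K) := i.toRingHom.toAlgebra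
  have : IsScalarTower K L (AlgebraicClosure K) :=
    IsScalarTower.of_algebraMap_eq fun k => (i.commutes k).symm
  rintro ⟨x, hx⟩
  obtain ⟨z, hz⟩ := ratMap_surjective hf (OnePoint.map i x)
  obtain ⟨y, rfl⟩ := exists_map_eq_of_iterate_ratMap (L := L) hf hα (n + 1) z (by
    rw [Function.iterate_succ_apply, hz, iterate_ratMap_map, hx, OnePoint.map_some, i.commutes])
  have hy : ratMap f L y = x :=
    onePointMap_injective (g := i) i.injective ((ratMap_map f i y).symm.trans hz)
  exact ⟨⟨y, by rw [Function.iterate_succ_apply, hy, hx]⟩, Subtype.ext hy⟩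

/-- Reduction maps from the tree of preimages of `t` to the tree of preimages of `α`, which are
equivariant, level by level, with respect to lifts of automorphisms. -/
theorem exists_specialization (hf : 2 ≤ ratDegree f) {α : K}
    (hα : ¬ IsStrictlyPostCritical f α) :
    ∃ r : ∀ n, Level f (algebraMap (RatFunc K) Ω RatFunc.X) n → Level f (algebraMap K L α) n,
      Function.Injective (r 1) ∧ ∀ (σ : L ≃ₐ[K] L) (n : ℕ), ∃ τ : Ω ≃ₐ[RatFunc K] Ω,
        (∀ y, r 1 (galoisLevel f RatFunc.X 1 τ y) = galoisLevel f α 1 σ (r 1 y)) ∧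
        ∀ y, r n (galoisLevel f RatFunc.X n τ y) = galoisLevel f α n σ (r n y) := by
  have : IsSepClosed L := IsSepClosure.sep_closed K
  let i : L →ₐ[K] AlgebraicClosure K := IsAlgClosed.lift
  let _ : Algebra L (AlgebraicClosure K) := i.toRingHom.toAlgebra
  have : IsScalarTower K L (AlgebraicClosure K) :=
    IsScalarTower.of_algebraMap_eq fun k => (i.commutes k).symm
  have hi : Function.Injective (OnePoint.map i) := onePointMap_injective i.injective
  let _ : Algebra (Polynomial K) Ω :=
    ((algebraMap (RatFunc K) Ω).comp (algebraMap (Polynomial K) (RatFunc K))).toAlgebra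
  have : IsScalarTower (Polynomial K) (RatFunc K) Ω := IsScalarTower.of_algebraMap_eq fun _ => rfl
  obtain ⟨V, _, _, φ, _, ht, hφ⟩ := exists_place Ω α
  have hX : algebraMap (Polynomial K) Ω Polynomial.X = algebraMap (RatFunc K) Ω RatFunc.X := by
    rw [← RatFunc.algebraMap_X]
    rfl
  have hred (n : ℕ) (x : OnePoint Ω)
      (hx : (ratMap f Ω)^[n] x = OnePoint.some (algebraMap (RatFunc K) Ω RatFunc.X)) :
      (ratMap f (AlgebraicClosure K))^[n] (reduction φ x) =
        OnePoint.some (algebraMap K (AlgebraicClosure K) α) := by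
    rw [← reduction_iterate_ratMap, hx, ← hX, ← hφ]
    exact dif_pos ht
  have hex (n : ℕ) (x : Level f (algebraMap (RatFunc K) Ω RatFunc.X) n) :
      ∃ y : Level f (algebraMap K L α) n, OnePoint.map i y.1 = reduction φ x.1 := by
    obtain ⟨y, hy⟩ := exists_map_eq_of_iterate_ratMap (L := L) hf hα n _ (hred n x.1 x.2)
    refine ⟨⟨y, hi ?_⟩, hy⟩
    rw [← iterate_ratMap_map, OnePoint.map_some, i.commutes, ← hred n x.1 x.2, ← hy]
    rfl
  choose r hr using hex
  refine ⟨r, ?_, ?_⟩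
  · rintro ⟨x, hx⟩ ⟨y, hy⟩ hxy
    apply Subtype.ext
    by_contra hne
    obtain ⟨a, rfl⟩ := exists_eq_coe_of_iterate_ratMap f hx
    obtain ⟨b, rfl⟩ := exists_eq_coe_of_iterate_ratMap f hy
    have h1 := hr 1 ⟨_, hx⟩
    rw [hxy, hr 1 ⟨_, hy⟩] at h1
    have h2 := two_le_ramificationIndex_reduction φ hf ⟨_, ht⟩
      (fun hab => hne (congrArg OnePoint.some hab)) (hx.trans (congrArg OnePoint.some hX.symm))
      (hy.trans (congrArg OnePoint.some hX.symm)) h1.symm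
    exact hα ⟨1, le_rfl, _, h2, hred 1 _ hx⟩
  · intro σ n
    have := finite_level hf (algebraMap (RatFunc K) Ω RatFunc.X) 1
    have := finite_level hf (algebraMap (RatFunc K) Ω RatFunc.X) n
    let σ' : AlgebraicClosure K ≃ₐ[K] AlgebraicClosure K := σ.liftNormal (AlgebraicClosure K)
    have hσ' (x : OnePoint L) : OnePoint.map σ' (OnePoint.map i x) =
        OnePoint.map i (OnePoint.map σ x) := by
      induction x using OnePoint.rec with
      | infty => rfl
      | coe a =>
        simp only [OnePoint.map_some, OnePoint.coe_eq_coe]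
        exact σ.liftNormal_commutes (AlgebraicClosure K) a
    obtain ⟨τ, hτ⟩ := exists_algEquiv_reduction_eq φ α ht hφ σ'
      -- Levels 1 and `n` are treated together: the same `τ` must determine the coset and supply the
      -- fixed vertex.
      (Sum.elim (fun x : Level f (algebraMap (RatFunc K) Ω RatFunc.X) 1 => x.1)
        (fun x : Level f (algebraMap (RatFunc K) Ω RatFunc.X) n => x.1))
    have key (m : ℕ) (y : Level f (algebraMap (RatFunc K) Ω RatFunc.X) m)
        (h : reduction φ (OnePoint.map τ y.1) = OnePoint.map σ' (reduction φ y.1)) :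
        r m (galoisLevel f RatFunc.X m τ y) = galoisLevel f α m σ (r m y) := by
      apply Subtype.ext
      apply hi
      rw [hr]
      change reduction φ (OnePoint.map τ y.1) = OnePoint.map i (OnePoint.map σ (r m y).1)
      rw [h, ← hr, hσ']
    exact ⟨τ, fun y => key 1 y (hτ (Sum.inl y)), fun y => key n y (hτ (Sum.inr y))⟩

/-- The map `ψ` is conjugation by the reduction bijection `θ`, not by `e`. The given `e` serves only
to compare cardinalities: of the first levels, which makes `θ` bijective, and of the groups, which
makes the injective `ψ` surjective. -/
theorem exists_surjective_to_monodromy (hf : 2 ≤ ratDegree f) {α : K}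
    (hα : ¬ IsStrictlyPostCritical f α)
    (e : Level f (algebraMap (RatFunc K) Ω RatFunc.X) 1 ≃ Level f (algebraMap K L α) 1)
    (he : (arithmeticMonodromy f Ω).map e.permCongrHom.toMonoidHom =
      levelGroup (arithmeticGroup L f α) 1) :
    ∃ ψ : levelGroup (arithmeticGroup L f α) 1 →* arithmeticMonodromy f Ω,
      Function.Surjective ψ ∧ ∀ (σ : L ≃ₐ[K] L) (n : ℕ)
        (h : levelAction f _ 1 (arborealRep L f α σ) ∈ levelGroup (arithmeticGroup L f α) 1),
        ∃ τ : Ω ≃ₐ[RatFunc K] Ω, ψ ⟨_, h⟩ = toMonodromy f τ ∧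
          ((∃ v, levelAction f _ n (arborealRep Ω f RatFunc.X τ) v = v) →
            ∃ v, levelAction f _ n (arborealRep L f α σ) v = v) := by
  have := finite_level hf (algebraMap (RatFunc K) Ω RatFunc.X) 1
  have := finite_level hf (algebraMap K L α) 1
  obtain ⟨r, hr, hrτ⟩ := exists_specialization (Ω := Ω) (L := L) hf hα
  let θ : Level f (algebraMap (RatFunc K) Ω RatFunc.X) 1 ≃ Level f (algebraMap K L α) 1 :=
    Equiv.ofBijective (r 1) (hr.bijective_of_nat_card_le (Nat.card_congr e).ge)
  have hθ (σ : L ≃ₐ[K] L) (τ : Ω ≃ₐ[RatFunc K] Ω)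
      (h : ∀ y, r 1 (galoisLevel f RatFunc.X 1 τ y) = galoisLevel f α 1 σ (r 1 y)) :
      θ.symm.permCongrHom (levelAction f _ 1 (arborealRep L f α σ)) =
        levelAction f _ 1 (arborealRep Ω f RatFunc.X τ) := by
    ext1 y
    change θ.symm (galoisLevel f α 1 σ (r 1 y)) = galoisLevel f RatFunc.X 1 τ y
    rw [← h]
    exact θ.symm_apply_apply _
  have hmem (g : levelGroup (arithmeticGroup L f α) 1) :
      θ.symm.permCongrHom g.1 ∈ arithmeticMonodromy f Ω := by
    obtain ⟨_, _, ⟨σ, rfl⟩, rfl⟩ := g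
    obtain ⟨τ, hτ, -⟩ := hrτ σ 1
    have h1 := (toMonodromy f τ).2
    rw [show (toMonodromy f τ).1 = _ from (hθ σ τ hτ).symm] at h1
    exact h1
  let ψ : levelGroup (arithmeticGroup L f α) 1 →* arithmeticMonodromy f Ω :=
    (θ.symm.permCongrHom.toMonoidHom.comp (Subgroup.subtype _)).codRestrict _ hmem
  have hψ : Function.Injective ψ := fun a b hab =>
    Subtype.ext (θ.symm.permCongrHom.injective (congrArg Subtype.val hab))
  have hcard : Nat.card (arithmeticMonodromy f Ω) ≤
      Nat.card (levelGroup (arithmeticGroup L f α) 1) := by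
    rw [← he]
    exact (Nat.card_congr ((arithmeticMonodromy f Ω).equivMapOfInjective _
      e.permCongrHom.injective).toEquiv).le
  refine ⟨ψ, (hψ.bijective_of_nat_card_le hcard).2, fun σ n h => ?_⟩
  obtain ⟨τ, hτ, hτn⟩ := hrτ σ n
  refine ⟨τ, Subtype.ext (hθ σ τ hτ), ?_⟩
  rintro ⟨v, hv⟩
  refine ⟨r n v, ?_⟩
  change galoisLevel f RatFunc.X n τ v = v at hv
  change galoisLevel f α n σ (r n v) = r n v
  rw [← hτn, hv]

end Specialization

end IteratedGalois

theorem theorem2 {K : Type*} [Field K] (f : RatFunc K) (hf : 2 ≤ ratDegree f)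
    (Ω : Type*) [Field Ω] [Algebra K Ω] [Algebra (RatFunc K) Ω] [IsScalarTower K (RatFunc K) Ω]
    [IsSepClosure (RatFunc K) Ω]
    (M : Set (MonodromyQuotient f Ω))
    (hM : IsBadMonodromySet f Ω M)
    (Ksep : Type*) [Field Ksep] [Algebra K Ksep] [IsSepClosure K Ksep] :
    (0 < (M.ncard : ℝ) / (Nat.card (MonodromyQuotient f Ω) : ℝ)) ∧
    (Tendsto (fixedProportion
          (arithmeticGroup Ω f (RatFunc.X : RatFunc K))) atTop
        (𝓝 (FPP
          (arithmeticGroup Ω f (RatFunc.X : RatFunc K)))) ∧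
      (M.ncard : ℝ) / (Nat.card (MonodromyQuotient f Ω) : ℝ) ≤
        FPP (arithmeticGroup Ω f (RatFunc.X : RatFunc K))) ∧
    (∀ α : K, ¬ IsStrictlyPostCritical f α →
      (∃ e : Level f (algebraMap (RatFunc K) Ω RatFunc.X) 1 ≃
          Level f (algebraMap K Ksep α) 1,
        (arithmeticMonodromy f Ω).map e.permCongrHom.toMonoidHom =
          levelGroup (arithmeticGroup Ksep f α) 1) →
      Tendsto (fixedProportion (arithmeticGroup Ksep f α)) atTop
        (𝓝 (FPP (arithmeticGroup Ksep f α))) ∧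
      (M.ncard : ℝ) / (Nat.card (MonodromyQuotient f Ω) : ℝ) ≤
        FPP (arithmeticGroup Ksep f α)) := by
  have hlev := finite_level hf (algebraMap (RatFunc K) Ω RatFunc.X)
  have := hlev 1
  refine ⟨?_, ?_, ?_⟩
  · have h1 : 0 < M.ncard := (Set.ncard_pos (Set.toFinite M)).2 hM.1
    have h2 : 0 < Nat.card (MonodromyQuotient f Ω) := Nat.card_pos
    positivity
  · have hs := parent_surjective_X f (exists_ratMap_eq_X hM)
    refine tendsto_FPP_and_le hlev hs _ _ fun n => ?_
    refine le_fixedProportion _ M hlev hs _ (MonoidHom.id _) Function.surjective_id ?_ n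
    rintro _ ⟨σ, rfl⟩ hσ n
    exact exists_fixed_of_mk_mem hM hσ n
  · rintro α hα ⟨e, he⟩
    have hlev' := finite_level hf (algebraMap K Ksep α)
    have hs := parent_surjective_of_not_isStrictlyPostCritical (L := Ksep) hf hα
    obtain ⟨ψ, hψ, hψσ⟩ := exists_surjective_to_monodromy hf hα e he
    refine tendsto_FPP_and_le hlev' hs _ _ fun n => ?_
    refine le_fixedProportion _ M hlev' hs _ ψ hψ ?_ n
    rintro _ ⟨σ, rfl⟩ hσ n
    obtain ⟨τ, hτ, hfix⟩ := hψσ σ n _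
    rw [hτ] at hσ
    exact hfix (exists_fixed_of_mk_mem hM hσ n)
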